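/- Let $M_1$ and $M_2$ be closed (compact, without boundary) smooth manifolds with $\dim M_1$ even and $\dim M_2$ odd, and put $M=M_1\times M_2$. Let $E_1\to M_1$ and $E_2\to M_2$ be complex Hermitian vector bundles (of constant finite rank). For $i=1,2$ let $\sigma_i$ be an elliptic symbol of some order $m_i>0$ acting in $E_i$: a family of endomorphisms $\sigma_i(x,\xi)$ of $E_{i,x}$, $(x,\xi)\in T^*M_i$, that is continuous and invertible for $\xi\neq 0$ and satisfies $\sigma_i(x,t\xi)=t^{m_i}\sigma_i(x,\xi)$ for $t>0$ (so $\sigma_i(x,0)=0$). Suppose that $\sigma_1$ is self-adjoint and odd, and that $\sigma_2$ is taken to its adjoint by the antipodal map: $$\sigma_1(x,\xi)^*=\sigma_1(x,\xi),\qquad \sigma_1(x,-\xi)=-\sigma_1(x,\xi),\qquad \sigma_2(x,-\xi)=\sigma_2(x,\xi)^*.$$ Let $$\sigma=\begin{pmatrix}\sigma_1\otimes 1 & 1\otimes\sigma_2^*\\ 1\otimes\sigma_2 & -\sigma_1\otimes 1\end{pmatrix}$$ be their cross product, a self-adjoint symbol on $T^*M$ acting in $(E_1\boxtimes E_2)\oplus(E_1\boxtimes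 E_2)$, evaluated at $(x_1,x_2,\xi_1,\xi_2)$ as $\sigma_1(x_1,\xi_1)$, $\sigma_2(x_2,\xi_2)$. Fix a Riemannian metric on $M$, let $\pi:S^*M\to M$ be the bundle of unit cospheres, let $p:S^*M\to P^*M$ be the quotient by the antipodal involution $(x,\xi)\mapsto(x,-\xi)$, and let $L_+(\sigma)\subset\pi^*\big((E_1\boxtimes E_2)\oplus(E_1\boxtimes E_2)\big)$ be the nonnegative spectral bundle of $\sigma$ over $S^*M$: its fibre at $(x,\xi)$ is the sum of the eigenspaces of $\sigma(x,\xi)$ with nonnegative eigenvalues. Then: 1. there is a complex vector bundle $L$ over $P^*M$ such that the pull-back $p^*L$ is isomorphic to $L_+(\sigma)$ over $S^*M$; 2. $L_+(\sigma)$ is isomorphic to an even bundle: there are a complex vector bundle $G$ over $M$ and a subbundle $K\subset\pi^*G$ over $S^*M$ with $K_{(x,-\xi)}=K_{(x,\xi)}\subset G_x$ for all $(x,\xi)\in S^*M$, such that $K\cong L_+(\sigma)$. (Vector bundles and isomorphisms are those of topological complex vector bundles.) -/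

import Mathlib

open Topology
open Bundle (TotalSpace Trivialization Pretrivialization Pullback ContinuousRiemannianMetric)
open scoped Manifold ContDiff TensorProduct

noncomputable section

/-! ### Complex vector bundles, families of subspaces, isomorphisms -/

/-- A complex vector bundle of finite rank over a topological space `X`. -/
structure ComplexVectorBundle (X : Type*) [TopologicalSpace X] where
  rank : ℕ
  Fiber : X → Type
  [addCommGroup : ∀ x, AddCommGroup (Fiber x)]
  [module : ∀ x, Module ℂ (Fiber x)]
  [fiberTopology : ∀ x, TopologicalSpace (Fiber x)]
  [totalTopology : TopologicalSpace (TotalSpace (EuclideanSpace ℂ (Fin rank)) Fiber)]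
  [fiberBundle : FiberBundle (EuclideanSpace ℂ (Fin rank)) Fiber]
  [vectorBundle : VectorBundle ℂ (EuclideanSpace ℂ (Fin rank)) Fiber]

attribute [instance] ComplexVectorBundle.addCommGroup ComplexVectorBundle.module
  ComplexVectorBundle.fiberTopology ComplexVectorBundle.totalTopology
  ComplexVectorBundle.fiberBundle ComplexVectorBundle.vectorBundle

/-- The standard fibre of a complex vector bundle. -/
abbrev ComplexVectorBundle.Model {X : Type*} [TopologicalSpace X] (L : ComplexVectorBundle X) :
    Type :=
  EuclideanSpace ℂ (Fin L.rank)

/-- The family of vector spaces `x ↦ K x ⊆ V x` given by a choice of a subspace in each fibre. -/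
def SubspaceFamily {X : Type*} {V : X → Type*} [∀ x, AddCommMonoid (V x)] [∀ x, Module ℂ (V x)]
    (K : ∀ x, Submodule ℂ (V x)) (x : X) : Type _ :=
  K x

instance SubspaceFamily.addCommMonoid {X : Type*} {V : X → Type*} [∀ x, AddCommMonoid (V x)]
    [∀ x, Module ℂ (V x)] (K : ∀ x, Submodule ℂ (V x)) (x : X) :
    AddCommMonoid (SubspaceFamily K x) :=
  inferInstanceAs (AddCommMonoid (K x))

instance SubspaceFamily.module {X : Type*} {V : X → Type*} [∀ x, AddCommMonoid (V x)]
    [∀ x, Module ℂ (V x)] (K : ∀ x, Submodule ℂ (V x)) (x : X) :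
    Module ℂ (SubspaceFamily K x) :=
  inferInstanceAs (Module ℂ (K x))

/-- The inclusion `K x ⊆ V x`. -/
def SubspaceFamily.incl {X : Type*} {V : X → Type*} [∀ x, AddCommMonoid (V x)]
    [∀ x, Module ℂ (V x)] (K : ∀ x, Submodule ℂ (V x)) (x : X) : SubspaceFamily K x →ₗ[ℂ] V x :=
  (K x).subtype

/-- The total space of a family of subspaces of a bundle `V` carries the topology of a subspace
of the total space of `V`. -/
instance SubspaceFamily.topologicalSpace {X : Type*} (F : Type*) {V : X → Type*}
    [∀ x, AddCommMonoid (V x)] [∀ x, Module ℂ (V x)] [TopologicalSpace (TotalSpace F V)]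
    (K : ∀ x, Submodule ℂ (V x)) : TopologicalSpace (TotalSpace F (SubspaceFamily K)) :=
  TopologicalSpace.induced
    (fun v : TotalSpace F (SubspaceFamily K) => (⟨v.1, SubspaceFamily.incl K v.1 v.2⟩ : TotalSpace F V))
    inferInstance

/-- Two families of complex vector spaces over `X` (with topologized total spaces) are isomorphic:
there are linear isomorphisms of the fibres which together form a homeomorphism of the total
spaces. If one of the families is a vector bundle, so is the other one, and for vector bundles
this is the usual notion of isomorphism. -/
def FamiliesIsomorphic {X : Type*} (F : Type*) (V : X → Type*)
    [∀ x, AddCommMonoid (V x)] [∀ x, Module ℂ (V x)] [TopologicalSpace (TotalSpace F V)]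
    (F' : Type*) (V' : X → Type*)
    [∀ x, AddCommMonoid (V' x)] [∀ x, Module ℂ (V' x)] [TopologicalSpace (TotalSpace F' V')] :
    Prop :=
  ∃ Φ : ∀ x, V x ≃ₗ[ℂ] V' x,
    IsHomeomorph (fun v : TotalSpace F V => (⟨v.1, Φ v.1 v.2⟩ : TotalSpace F' V'))

section MapL

variable {A B C D : Type*} [NormedAddCommGroup A] [InnerProductSpace ℂ A]
  [NormedAddCommGroup B] [InnerProductSpace ℂ B] [NormedAddCommGroup C] [InnerProductSpace ℂ C]
  [NormedAddCommGroup D] [InnerProductSpace ℂ D]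

theorem continuous_rTensorL : Continuous (fun f : A →L[ℂ] B => f.rTensor D) := by
  refine AddMonoidHomClass.continuous_of_bound
    (AddMonoidHom.mk' (fun f : A →L[ℂ] B => f.rTensor D) (ContinuousLinearMap.rTensor_add D)) 1 ?_
  intro f; exact (ContinuousLinearMap.norm_rTensor_le D f).trans (one_mul _).ge

theorem continuous_lTensorL : Continuous (fun f : A →L[ℂ] B => f.lTensor D) := by
  refine AddMonoidHomClass.continuous_of_bound
    (AddMonoidHom.mk' (fun f : A →L[ℂ] B => f.lTensor D) (ContinuousLinearMap.lTensor_add D)) 1 ?_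
  intro f; exact (ContinuousLinearMap.norm_lTensor_le D f).trans (one_mul _).ge

theorem ContinuousOn.mapL {X : Type*} [TopologicalSpace X] {s : Set X} {f : X → A →L[ℂ] B}
    {g : X → C →L[ℂ] D} (hf : ContinuousOn f s) (hg : ContinuousOn g s) :
    ContinuousOn (fun x => TensorProduct.mapL (f x) (g x)) s := by
  have h1 : ContinuousOn (fun x => (f x).rTensor D) s := continuous_rTensorL.comp_continuousOn hf
  have h2 : ContinuousOn (fun x => (g x).lTensor A) s := continuous_lTensorL.comp_continuousOn hg
  exact h1.clm_comp h2

end MapL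

/-! ### The external tensor product of two Hermitian vector bundles -/

section ExternalTensor

variable {B₁ B₂ : Type*} [TopologicalSpace B₁] [TopologicalSpace B₂]
  (F₁ : Type*) [NormedAddCommGroup F₁] [InnerProductSpace ℂ F₁]
  (E₁ : B₁ → Type*) [∀ x, NormedAddCommGroup (E₁ x)] [∀ x, InnerProductSpace ℂ (E₁ x)]
  [TopologicalSpace (TotalSpace F₁ E₁)] [FiberBundle F₁ E₁] [VectorBundle ℂ F₁ E₁]
  (F₂ : Type*) [NormedAddCommGroup F₂] [InnerProductSpace ℂ F₂]
  (E₂ : B₂ → Type*) [∀ x, NormedAddCommGroup (E₂ x)] [∀ x, InnerProductSpace ℂ (E₂ x)]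
  [TopologicalSpace (TotalSpace F₂ E₂)] [FiberBundle F₂ E₂] [VectorBundle ℂ F₂ E₂]

/-- The fibre `E₁ x₁ ⊗ E₂ x₂` of the external tensor product. -/
abbrev ExtTensor (x : B₁ × B₂) : Type _ := E₁ x.1 ⊗[ℂ] E₂ x.2

variable {F₁ E₁ F₂ E₂}

/-- The product of two local trivializations. -/
def ExtTensor.pretrivialization (e₁ : Trivialization F₁ (TotalSpace.proj (F := F₁) (E := E₁))) (e₂ : Trivialization F₂ (TotalSpace.proj (F := F₂) (E := E₂)))
    [e₁.IsLinear ℂ] [e₂.IsLinear ℂ] :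
    Pretrivialization (F₁ ⊗[ℂ] F₂) (TotalSpace.proj (F := F₁ ⊗[ℂ] F₂) (E := ExtTensor E₁ E₂)) where
  toFun p := ⟨p.1, TensorProduct.mapL (e₁.continuousLinearMapAt ℂ p.1.1)
    (e₂.continuousLinearMapAt ℂ p.1.2) p.2⟩
  invFun p := ⟨p.1, TensorProduct.mapL (e₁.symmL ℂ p.1.1) (e₂.symmL ℂ p.1.2) p.2⟩
  source := TotalSpace.proj ⁻¹' (e₁.baseSet ×ˢ e₂.baseSet)
  target := (e₁.baseSet ×ˢ e₂.baseSet) ×ˢ Set.univ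
  map_source' := fun ⟨_, _⟩ h => ⟨h, Set.mem_univ _⟩
  map_target' := fun ⟨_, _⟩ h => h.1
  left_inv' := fun ⟨x, v⟩ ⟨h₁, h₂⟩ => by
    simp only [TotalSpace.mk_inj]
    rw [← ContinuousLinearMap.comp_apply, ← TensorProduct.mapL_comp]
    have a : e₁.symmL ℂ x.1 ∘L e₁.continuousLinearMapAt ℂ x.1 = .id ℂ _ := by
      ext v; exact e₁.symmL_continuousLinearMapAt h₁ v
    have b : e₂.symmL ℂ x.2 ∘L e₂.continuousLinearMapAt ℂ x.2 = .id ℂ _ := by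
      ext v; exact e₂.symmL_continuousLinearMapAt h₂ v
    rw [a, b, TensorProduct.mapL_id_id]; rfl
  right_inv' := fun ⟨x, v⟩ ⟨⟨h₁, h₂⟩, _⟩ => by
    simp only [Prod.mk_right_inj]
    rw [← ContinuousLinearMap.comp_apply, ← TensorProduct.mapL_comp]
    have a : e₁.continuousLinearMapAt ℂ x.1 ∘L e₁.symmL ℂ x.1 = .id ℂ _ := by
      ext v; exact e₁.continuousLinearMapAt_symmL h₁ v
    have b : e₂.continuousLinearMapAt ℂ x.2 ∘L e₂.symmL ℂ x.2 = .id ℂ _ := by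
      ext v; exact e₂.continuousLinearMapAt_symmL h₂ v
    rw [a, b, TensorProduct.mapL_id_id]; rfl
  open_target := (e₁.open_baseSet.prod e₂.open_baseSet).prod isOpen_univ
  baseSet := e₁.baseSet ×ˢ e₂.baseSet
  open_baseSet := e₁.open_baseSet.prod e₂.open_baseSet
  source_eq := rfl
  target_eq := rfl
  proj_toFun _ _ := rfl

instance ExtTensor.pretrivialization_isLinear (e₁ : Trivialization F₁ (TotalSpace.proj (F := F₁) (E := E₁)))
    (e₂ : Trivialization F₂ (TotalSpace.proj (F := F₂) (E := E₂))) [e₁.IsLinear ℂ] [e₂.IsLinear ℂ] :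
    (ExtTensor.pretrivialization e₁ e₂).IsLinear ℂ where
  linear x _ :=
    { map_add v w := map_add (TensorProduct.mapL (e₁.continuousLinearMapAt ℂ x.1)
        (e₂.continuousLinearMapAt ℂ x.2)) v w
      map_smul c v := map_smul (TensorProduct.mapL (e₁.continuousLinearMapAt ℂ x.1)
        (e₂.continuousLinearMapAt ℂ x.2)) c v }

set_option linter.unusedSectionVars false in
theorem ExtTensor.pretrivialization_symm_apply (e₁ : Trivialization F₁ (TotalSpace.proj (F := F₁) (E := E₁)))
    (e₂ : Trivialization F₂ (TotalSpace.proj (F := F₂) (E := E₂))) [e₁.IsLinear ℂ] [e₂.IsLinear ℂ] {x : B₁ × B₂}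
    (hx : x ∈ e₁.baseSet ×ˢ e₂.baseSet) (v : F₁ ⊗[ℂ] F₂) :
    (ExtTensor.pretrivialization e₁ e₂).symm x v =
      TensorProduct.mapL (e₁.symmL ℂ x.1) (e₂.symmL ℂ x.2) v := by
  rw [Pretrivialization.symm_apply]
  · rfl
  · exact hx

theorem ExtTensor.continuousOn_coordChange (e₁ e₁' : Trivialization F₁ (TotalSpace.proj (F := F₁) (E := E₁)))
    (e₂ e₂' : Trivialization F₂ (TotalSpace.proj (F := F₂) (E := E₂))) [MemTrivializationAtlas e₁] [MemTrivializationAtlas e₁']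
    [MemTrivializationAtlas e₂] [MemTrivializationAtlas e₂'] :
    ContinuousOn (fun x : B₁ × B₂ =>
      TensorProduct.mapL (e₁.coordChangeL ℂ e₁' x.1 : F₁ →L[ℂ] F₁)
        (e₂.coordChangeL ℂ e₂' x.2 : F₂ →L[ℂ] F₂))
      ((e₁.baseSet ×ˢ e₂.baseSet) ∩ (e₁'.baseSet ×ˢ e₂'.baseSet)) := by
  have h₁ : ContinuousOn (fun x : B₁ × B₂ => (e₁.coordChangeL ℂ e₁' x.1 : F₁ →L[ℂ] F₁))
      ((e₁.baseSet ×ˢ e₂.baseSet) ∩ (e₁'.baseSet ×ˢ e₂'.baseSet)) :=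
    (_root_.continuousOn_coordChange ℂ e₁ e₁').comp continuousOn_fst
      (fun _ hx => ⟨hx.1.1, hx.2.1⟩)
  have h₂ : ContinuousOn (fun x : B₁ × B₂ => (e₂.coordChangeL ℂ e₂' x.2 : F₂ →L[ℂ] F₂))
      ((e₁.baseSet ×ˢ e₂.baseSet) ∩ (e₁'.baseSet ×ˢ e₂'.baseSet)) :=
    (_root_.continuousOn_coordChange ℂ e₂ e₂').comp continuousOn_snd
      (fun _ hx => ⟨hx.1.2, hx.2.2⟩)
  exact h₁.mapL h₂

theorem ExtTensor.coordChange_apply (e₁ e₁' : Trivialization F₁ (TotalSpace.proj (F := F₁) (E := E₁)))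
    (e₂ e₂' : Trivialization F₂ (TotalSpace.proj (F := F₂) (E := E₂))) [e₁.IsLinear ℂ] [e₂.IsLinear ℂ] [e₁'.IsLinear ℂ]
    [e₂'.IsLinear ℂ] {x : B₁ × B₂} (hx : x ∈ e₁.baseSet ×ˢ e₂.baseSet)
    (hx' : x ∈ e₁'.baseSet ×ˢ e₂'.baseSet) (v : F₁ ⊗[ℂ] F₂) :
    TensorProduct.mapL (e₁.coordChangeL ℂ e₁' x.1 : F₁ →L[ℂ] F₁)
        (e₂.coordChangeL ℂ e₂' x.2 : F₂ →L[ℂ] F₂) v =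
      (ExtTensor.pretrivialization e₁' e₂'
        ⟨x, (ExtTensor.pretrivialization e₁ e₂).symm x v⟩).2 := by
  have a : (e₁.coordChangeL ℂ e₁' x.1 : F₁ →L[ℂ] F₁) =
      e₁'.continuousLinearMapAt ℂ x.1 ∘L e₁.symmL ℂ x.1 := by
    ext w
    simp only [ContinuousLinearEquiv.coe_coe, ContinuousLinearMap.comp_apply]
    rw [e₁.coordChangeL_apply e₁' ⟨hx.1, hx'.1⟩, e₁.symmL_apply hx.1,
      Trivialization.continuousLinearMapAt_apply, e₁'.coe_linearMapAt_of_mem hx'.1]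
  have b : (e₂.coordChangeL ℂ e₂' x.2 : F₂ →L[ℂ] F₂) =
      e₂'.continuousLinearMapAt ℂ x.2 ∘L e₂.symmL ℂ x.2 := by
    ext w
    simp only [ContinuousLinearEquiv.coe_coe, ContinuousLinearMap.comp_apply]
    rw [e₂.coordChangeL_apply e₂' ⟨hx.2, hx'.2⟩, e₂.symmL_apply hx.2,
      Trivialization.continuousLinearMapAt_apply, e₂'.coe_linearMapAt_of_mem hx'.2]
  rw [ExtTensor.pretrivialization_symm_apply e₁ e₂ hx, a, b, TensorProduct.mapL_comp]
  rfl

variable (F₁ E₁ F₂ E₂)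

/-- The external tensor product `E₁ ⊠ E₂` over `B₁ × B₂`, as a prebundle: its trivializations are
the tensor products of trivializations of the factors. -/
def ExtTensor.vectorPrebundle : VectorPrebundle ℂ (F₁ ⊗[ℂ] F₂) (ExtTensor E₁ E₂) where
  pretrivializationAtlas :=
    {e | ∃ (e₁ : Trivialization F₁ (TotalSpace.proj (F := F₁) (E := E₁))) (e₂ : Trivialization F₂ (TotalSpace.proj (F := F₂) (E := E₂)))
      (_ : MemTrivializationAtlas e₁) (_ : MemTrivializationAtlas e₂),
        e = ExtTensor.pretrivialization e₁ e₂}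
  pretrivialization_linear' := by
    rintro _ ⟨e₁, he₁, e₂, he₂, rfl⟩
    infer_instance
  pretrivializationAt x :=
    ExtTensor.pretrivialization (FiberBundle.trivializationAt F₁ E₁ x.1) (FiberBundle.trivializationAt F₂ E₂ x.2)
  mem_base_pretrivializationAt x :=
    ⟨FiberBundle.mem_baseSet_trivializationAt F₁ E₁ x.1, FiberBundle.mem_baseSet_trivializationAt F₂ E₂ x.2⟩
  pretrivialization_mem_atlas x :=
    ⟨FiberBundle.trivializationAt F₁ E₁ x.1, FiberBundle.trivializationAt F₂ E₂ x.2, inferInstance, inferInstance, rfl⟩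
  exists_coordChange := by
    rintro _ ⟨e₁, e₂, he₁, he₂, rfl⟩ _ ⟨e₁', e₂', he₁', he₂', rfl⟩
    exact ⟨fun x => TensorProduct.mapL (e₁.coordChangeL ℂ e₁' x.1 : F₁ →L[ℂ] F₁)
      (e₂.coordChangeL ℂ e₂' x.2 : F₂ →L[ℂ] F₂),
      ExtTensor.continuousOn_coordChange e₁ e₁' e₂ e₂',
      fun x hx v => ExtTensor.coordChange_apply e₁ e₁' e₂ e₂' hx.1 hx.2 v⟩
  totalSpaceMk_isInducing := by
    intro x
    let e₁ := FiberBundle.trivializationAt F₁ E₁ x.1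
    let e₂ := FiberBundle.trivializationAt F₂ E₂ x.2
    have h₁ : x.1 ∈ e₁.baseSet := FiberBundle.mem_baseSet_trivializationAt F₁ E₁ x.1
    have h₂ : x.2 ∈ e₂.baseSet := FiberBundle.mem_baseSet_trivializationAt F₂ E₂ x.2
    have a : e₁.symmL ℂ x.1 ∘L e₁.continuousLinearMapAt ℂ x.1 = .id ℂ _ := by
      ext v; exact e₁.symmL_continuousLinearMapAt h₁ v
    have b : e₂.symmL ℂ x.2 ∘L e₂.continuousLinearMapAt ℂ x.2 = .id ℂ _ := by
      ext v; exact e₂.symmL_continuousLinearMapAt h₂ v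
    let φ : E₁ x.1 ⊗[ℂ] E₂ x.2 →L[ℂ] F₁ ⊗[ℂ] F₂ :=
      TensorProduct.mapL (e₁.continuousLinearMapAt ℂ x.1) (e₂.continuousLinearMapAt ℂ x.2)
    let ψ : F₁ ⊗[ℂ] F₂ →L[ℂ] E₁ x.1 ⊗[ℂ] E₂ x.2 :=
      TensorProduct.mapL (e₁.symmL ℂ x.1) (e₂.symmL ℂ x.2)
    have hψφ : (ψ : F₁ ⊗[ℂ] F₂ → E₁ x.1 ⊗[ℂ] E₂ x.2) ∘ φ = id := by
      funext v
      change (ψ ∘L φ) v = v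
      simp only [φ, ψ]
      rw [← TensorProduct.mapL_comp, a, b, TensorProduct.mapL_id_id]; rfl
    have hφ : IsInducing φ :=
      IsInducing.of_comp φ.continuous ψ.continuous (by rw [hψφ]; exact IsInducing.id)
    exact Topology.isInducing_const_prod.mpr hφ

instance ExtTensor.topologicalSpaceTotalSpace :
    TopologicalSpace (TotalSpace (F₁ ⊗[ℂ] F₂) (ExtTensor E₁ E₂)) :=
  (ExtTensor.vectorPrebundle F₁ E₁ F₂ E₂).totalSpaceTopology

instance ExtTensor.fiberBundle : FiberBundle (F₁ ⊗[ℂ] F₂) (ExtTensor E₁ E₂) :=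
  (ExtTensor.vectorPrebundle F₁ E₁ F₂ E₂).toFiberBundle

instance ExtTensor.vectorBundle : VectorBundle ℂ (F₁ ⊗[ℂ] F₂) (ExtTensor E₁ E₂) :=
  (ExtTensor.vectorPrebundle F₁ E₁ F₂ E₂).toVectorBundle

end ExternalTensor

/-! ### The cotangent bundle, cospheres and their projectivization -/

section Cotangent

variable {E : Type*} [NormedAddCommGroup E] [NormedSpace ℝ E] {H : Type*} [TopologicalSpace H]
  (I : ModelWithCorners ℝ E H) {M : Type*} [TopologicalSpace M] [ChartedSpace H M]

/-- The cotangent space `T*ₓM`. -/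
abbrev CotangentSpace (x : M) : Type _ := TangentSpace I x →L[ℝ] ℝ

variable (M) in
/-- The total space of the cotangent bundle `T*M`. -/
abbrev CotangentBundle : Type _ := TotalSpace (E →L[ℝ] ℝ) (fun x : M => CotangentSpace I x)

variable [IsManifold I 1 M]

variable (M) in
/-- A Riemannian metric on `M`, given as a continuous family of inner products on the cotangent
spaces (by duality this is the same as a continuous family of inner products on the tangent
spaces). -/
abbrev CotangentMetric : Type _ :=
  ContinuousRiemannianMetric (E →L[ℝ] ℝ) (fun x : M => CotangentSpace I x)

variable {I}

/-- The bundle of cospheres `S*M`: the covectors of length one with respect to the metric `g`. -/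
abbrev CosphereBundle (g : CotangentMetric I M) : Type _ :=
  {ξ : CotangentBundle I M // g.inner ξ.1 ξ.2 ξ.2 = 1}

/-- The projection `π : S*M → M`. -/
def CosphereBundle.proj (g : CotangentMetric I M) : C(CosphereBundle g, M) where
  toFun ξ := ξ.1.1
  continuous_toFun := (FiberBundle.continuous_proj (E →L[ℝ] ℝ)
    (fun x : M => CotangentSpace I x)).comp continuous_subtype_val

variable {g : CotangentMetric I M}

/-- The antipodal involution `α (x, ξ) = (x, -ξ)` of `S*M`. -/
def CosphereBundle.antipode (ξ : CosphereBundle g) : CosphereBundle g :=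
  ⟨⟨ξ.1.1, -ξ.1.2⟩, by simpa using ξ.2⟩

set_option linter.unusedSectionVars false in
theorem CosphereBundle.antipode_antipode (ξ : CosphereBundle g) : ξ.antipode.antipode = ξ := by
  obtain ⟨⟨x, v⟩, h⟩ := ξ
  exact Subtype.ext (congrArg (TotalSpace.mk x) (neg_neg v))

variable (g) in
/-- The relation identifying antipodal points of the cospheres. -/
def antipodalSetoid : Setoid (CosphereBundle g) where
  r ξ η := η = ξ ∨ η = ξ.antipode
  iseqv :=
    { refl := fun _ => Or.inl rfl
      symm := by
        rintro ξ η (rfl | rfl)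
        · exact Or.inl rfl
        · exact Or.inr (ξ.antipode_antipode).symm
      trans := by
        rintro ξ η ζ (rfl | rfl) (rfl | rfl)
        · exact Or.inl rfl
        · exact Or.inr rfl
        · exact Or.inr rfl
        · exact Or.inl ξ.antipode_antipode }

variable (g) in
/-- The projectivized cotangent bundle `P*M`, the quotient of `S*M` by the antipodal involution;
its fibre over `x` is the projective space of lines in `T*ₓM`. -/
abbrev ProjCotangentBundle : Type _ := Quotient (antipodalSetoid g)

variable (g) in
/-- The projection `p : S*M → P*M`. -/
def CosphereBundle.toProj : C(CosphereBundle g, ProjCotangentBundle g) where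
  toFun := Quotient.mk _
  continuous_toFun := continuous_quotient_mk'

end Cotangent

/-! ### Elliptic symbols and their cross product -/

/-- The fibrewise inner products of a complex vector bundle form a (continuous) Hermitian metric.
By polarization it is enough to say that the norm is continuous on the total space. -/
def IsHermitianBundle {X : Type*} [TopologicalSpace X] (F : Type*) (E : X → Type*)
    [∀ x, NormedAddCommGroup (E x)] [TopologicalSpace (TotalSpace F E)] : Prop :=
  Continuous (fun v : TotalSpace F E => ‖v.2‖)

section Symbol

variable {B : Type*} [NormedAddCommGroup B] [NormedSpace ℝ B] {H : Type*} [TopologicalSpace H]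
  (I : ModelWithCorners ℝ B H) {M : Type*} [TopologicalSpace M] [ChartedSpace H M]
  [IsManifold I 1 M]
  (F : Type*) [NormedAddCommGroup F] [InnerProductSpace ℂ F]
  {E : M → Type*} [∀ x, NormedAddCommGroup (E x)] [∀ x, InnerProductSpace ℂ (E x)]
  [TopologicalSpace (TotalSpace F E)] [FiberBundle F E] [VectorBundle ℂ F E]

/-- `σ` is an elliptic symbol of order `m`, acting in the vector bundle `E` over `M`: a family of
endomorphisms `σ (x, ξ)` of `E x`, depending continuously on the nonzero covector `(x, ξ)`,
positively homogeneous of degree `m` in `ξ`, and invertible for `ξ ≠ 0`.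

The symbol is also defined on the zero section; if `m > 0`, it vanishes there by homogeneity. -/
structure IsEllipticSymbol (m : ℝ) (σ : ∀ x : M, CotangentSpace I x → (E x →L[ℂ] E x)) : Prop where
  continuousOn : ContinuousOn
    (fun ξ : CotangentBundle I M =>
      (⟨ξ.1, σ ξ.1 ξ.2⟩ : TotalSpace (F →L[ℂ] F) (fun x : M => E x →L[ℂ] E x)))
    {ξ | ξ.2 ≠ 0}
  homogeneous : ∀ (x : M) (ξ : CotangentSpace I x) (t : ℝ), 0 < t →
    σ x (t • ξ) = ((t ^ m : ℝ) : ℂ) • σ x ξ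
  elliptic : ∀ (x : M) (ξ : CotangentSpace I x), ξ ≠ 0 → Function.Bijective (σ x ξ)

end Symbol

/-- The nonnegative spectral subspace of an endomorphism: the sum of the eigenspaces with
nonnegative (real) eigenvalues. -/
def nonnegSpectralSubspace {V : Type*} [AddCommGroup V] [Module ℂ V] (T : V →ₗ[ℂ] V) :
    Submodule ℂ V :=
  ⨆ (μ : ℝ) (_ : 0 ≤ μ), Module.End.eigenspace T (μ : ℂ)

/-- The operator on `V × V` given by the block matrix `(a, b; c, d)`:
`(u, v) ↦ (a u + b v, c u + d v)`. -/
def blockOperator {V : Type*} [NormedAddCommGroup V] [NormedSpace ℂ V] (a b c d : V →L[ℂ] V) :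
    V × V →L[ℂ] V × V :=
  (a.coprod b).prod (c.coprod d)

section CrossProduct

variable {B₁ : Type*} [NormedAddCommGroup B₁] [NormedSpace ℝ B₁] {H₁ : Type*} [TopologicalSpace H₁]
  {I₁ : ModelWithCorners ℝ B₁ H₁} {M₁ : Type*} [TopologicalSpace M₁] [ChartedSpace H₁ M₁]
  {B₂ : Type*} [NormedAddCommGroup B₂] [NormedSpace ℝ B₂] {H₂ : Type*} [TopologicalSpace H₂]
  {I₂ : ModelWithCorners ℝ B₂ H₂} {M₂ : Type*} [TopologicalSpace M₂] [ChartedSpace H₂ M₂]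

/-- The component in `T*M₁` of a covector on `M₁ × M₂` (its pullback under the inclusion
`y ↦ (y, x₂)` of `M₁`). -/
def CotangentSpace.fst {x : M₁ × M₂} (ξ : CotangentSpace (I₁.prod I₂) x) :
    CotangentSpace I₁ x.1 :=
  ξ.comp (ContinuousLinearMap.inl ℝ (TangentSpace I₁ x.1) (TangentSpace I₂ x.2))

/-- The component in `T*M₂` of a covector on `M₁ × M₂` (its pullback under the inclusion
`y ↦ (x₁, y)` of `M₂`). -/
def CotangentSpace.snd {x : M₁ × M₂} (ξ : CotangentSpace (I₁.prod I₂) x) :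
    CotangentSpace I₂ x.2 :=
  ξ.comp (ContinuousLinearMap.inr ℝ (TangentSpace I₁ x.1) (TangentSpace I₂ x.2))

variable (E₁ : M₁ → Type*) [∀ x, NormedAddCommGroup (E₁ x)] [∀ x, InnerProductSpace ℂ (E₁ x)]
  (E₂ : M₂ → Type*) [∀ x, NormedAddCommGroup (E₂ x)] [∀ x, InnerProductSpace ℂ (E₂ x)]

/-- The fibre of the bundle `(E₁ ⊠ E₂) ⊕ (E₁ ⊠ E₂)` over `M₁ × M₂`, in which the cross product
acts. -/
abbrev CrossBundle : M₁ × M₂ → Type _ := ExtTensor E₁ E₂ ×ᵇ ExtTensor E₁ E₂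

/-- The standard fibre of `(E₁ ⊠ E₂) ⊕ (E₁ ⊠ E₂)`. -/
abbrev CrossModel (F₁ F₂ : Type*) [NormedAddCommGroup F₁] [InnerProductSpace ℂ F₁]
    [NormedAddCommGroup F₂] [InnerProductSpace ℂ F₂] : Type _ :=
  (F₁ ⊗[ℂ] F₂) × (F₁ ⊗[ℂ] F₂)

variable {E₁ E₂} [∀ x, CompleteSpace (E₂ x)]

/-- The cross product of the symbols `σ₁` and `σ₂`: the matrix
`(σ₁ ⊗ 1, 1 ⊗ σ₂*; 1 ⊗ σ₂, -σ₁ ⊗ 1)` acting on `(E₁ ⊠ E₂) ⊕ (E₁ ⊠ E₂)`. -/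
def crossSymbol (σ₁ : ∀ x : M₁, CotangentSpace I₁ x → (E₁ x →L[ℂ] E₁ x))
    (σ₂ : ∀ x : M₂, CotangentSpace I₂ x → (E₂ x →L[ℂ] E₂ x))
    (x : M₁ × M₂) (ξ : CotangentSpace (I₁.prod I₂) x) :
    CrossBundle E₁ E₂ x →L[ℂ] CrossBundle E₁ E₂ x :=
  blockOperator
    (TensorProduct.mapL (σ₁ x.1 ξ.fst) (ContinuousLinearMap.id ℂ (E₂ x.2)))
    (TensorProduct.mapL (ContinuousLinearMap.id ℂ (E₁ x.1))
      (ContinuousLinearMap.adjoint (σ₂ x.2 ξ.snd)))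
    (TensorProduct.mapL (ContinuousLinearMap.id ℂ (E₁ x.1)) (σ₂ x.2 ξ.snd))
    (TensorProduct.mapL (-σ₁ x.1 ξ.fst) (ContinuousLinearMap.id ℂ (E₂ x.2)))

end CrossProduct

section SpectralBundle

variable {B : Type*} [NormedAddCommGroup B] [NormedSpace ℝ B] {H : Type*} [TopologicalSpace H]
  {I : ModelWithCorners ℝ B H} {M : Type*} [TopologicalSpace M] [ChartedSpace H M]
  [IsManifold I 1 M] (g : CotangentMetric I M)
  {W : M → Type*} [∀ x, AddCommGroup (W x)] [∀ x, Module ℂ (W x)] [∀ x, TopologicalSpace (W x)]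

/-- The nonnegative spectral bundle `L₊(σ) ⊆ π*W` over `S*M` of a symbol `σ` acting in `W`. -/
def nonnegSpectralBundle (σ : ∀ x : M, CotangentSpace I x → (W x →L[ℂ] W x)) :
    ∀ ξ : CosphereBundle g, Submodule ℂ ((CosphereBundle.proj g *ᵖ W) ξ) :=
  fun ξ => nonnegSpectralSubspace (V := W ξ.1.1) (σ ξ.1.1 ξ.1.2 : W ξ.1.1 →ₗ[ℂ] W ξ.1.1)

/-- A family of subspaces `K (x, ξ) ⊆ (π*W) (x, ξ) = W x` over `S*M` is even if it is invariant
under the antipodal involution: `K (x, -ξ) = K (x, ξ)` as subspaces of `W x`. -/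
def IsEvenFamily (K : ∀ ξ : CosphereBundle g, Submodule ℂ ((CosphereBundle.proj g *ᵖ W) ξ)) :
    Prop :=
  ∀ ξ : CosphereBundle g, K ξ.antipode = K ξ

end SpectralBundle

end

/-!
Let `J (u, v) = (v, u)` be the swap of the two summands of `(E₁ ⊠ E₂) ⊕ (E₁ ⊠ E₂)`. Since `σ₁` is odd
and `σ₂(-ξ) = σ₂(ξ)*`, the swap intertwines the cross product at antipodal covectors,
`J σ(ξ) = σ(-ξ) J` (`crossSymbol_neg_swap`), so it carries the fibre of `L₊(σ)` at `ξ` to the fibre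
at `-ξ`.

This symmetry alone makes `L₊(σ)` even. Embed `E₁ ⊠ E₂` in a trivial bundle with fibre `Y`, and
`T*M` in a trivial bundle by `ξ ↦ f ξ`, linear and injective on the fibres. The maps
`(u, v) ↦ (u + v, f ξ ⊗ (u - v))` embed `Y ⊕ Y` in a fixed space and are invariant under
`(ξ, w) ↦ (-ξ, J w)` (`oddEmbedding_neg_swap`). The image of `L₊(σ)` under them is a family of
subspaces `K ξ` of a fixed space with `K (-ξ) = K ξ`: it is an even bundle inside a trivial bundle
over `M`, and being constant on the fibres of `S*M → P*M` it descends to `P*M`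
(`exists_even_and_descent_of_swap`).

What has to be known about `L₊(σ)` is that it is a vector bundle. A family of subspaces of a fixed
finite-dimensional space is a vector bundle as soon as its dimension is constant and its total space
is closed (`ComplexVectorBundle.exists_of_isClosed`); these two conditions also pass directly to the
quotient `P*M`.

* The dimension of `L₊(σ)` is `rank E₁ * rank E₂`, because `σ(ξ)` is invertible and diagonalizable,
  and its positive and negative eigenspaces are exchanged by an invertible operator that
  anticommutes with it (`finrank_nonnegSpectralSubspace_blockOperator`).
* The total space is closed because, for an operator `T` of size `k` that is diagonalizable with real
  eigenvalues, `w` lies in the nonnegative spectral subspace exactly if `∏ᵢ (sᵢ T - (1 - sᵢ)) w = 0`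
  for some `s` in the compact cube `[0, 1]^k` (`mem_nonnegSpectralSubspace_iff_affineProd`). This
  needs `σ` to be continuous on `S*M`, where one of the two components of a covector may vanish; the
  positivity of the orders makes `σ₁` and `σ₂` continuous across the zero sections
  (`IsEllipticSymbol.continuous`). The continuity of `σ₂*` follows from that of `σ₂` by
  `σ₂(ξ)* = σ₂(-ξ)`.
-/

set_option linter.unusedSectionVars false

/-! ### Closed families of subspaces of constant dimension are vector bundles -/

theorem IsCompact.isClosed_setOf_exists_mem {X A : Type*} [TopologicalSpace X] [TopologicalSpace A]
    {S : Set A} (hS : IsCompact S) {C : Set (X × A)} (hC : IsClosed C) :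
    IsClosed {x | ∃ v ∈ S, (x, v) ∈ C} := by
  have := isCompact_iff_compactSpace.1 hS
  have h : IsClosed {p : X × S | (p.1, (p.2 : A)) ∈ C} :=
    hC.preimage (continuous_fst.prodMk (continuous_subtype_val.comp continuous_snd))
  convert isClosedMap_fst_of_compactSpace _ h using 1
  ext x
  simp

namespace ClosedFamily

variable {X : Type*} [TopologicalSpace X] {A : Type*} [NormedAddCommGroup A] [NormedSpace ℂ A]
  [FiniteDimensional ℂ A] {F : Type*} [NormedAddCommGroup F] [NormedSpace ℂ F]
  (K : X → Submodule ℂ A)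

/-- The points over which the linear map `φ` is injective on the family `K`, and so gives a chart
of it. -/
def chartDomain (φ : A →L[ℂ] F) : Set X := {x | ∀ v ∈ K x, φ v = 0 → v = 0}

/-- The inverse of the restriction of `φ` to `K x` (a junk value unless `φ` is bijective there). -/
noncomputable def chartInv (φ : A →L[ℂ] F) (x : X) : F → K x :=
  Function.invFun (fun v : K x => φ v)

variable {K}

/-- For a closed family of subspaces, avoiding a closed set on the unit sphere is an open condition
on the base point. -/
theorem isOpen_setOf_forall_unit {S : Set A} (hK : IsClosed {p : X × A | p.2 ∈ K p.1})
    (hS : IsClosed S) : IsOpen {x | ∀ v ∈ K x, ‖v‖ = 1 → v ∉ S} := by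
  have := FiniteDimensional.proper ℂ A
  have h := (isCompact_sphere (0 : A) 1).isClosed_setOf_exists_mem
    (hK.inter (hS.preimage (continuous_snd (X := X))))
  convert h.isOpen_compl using 1
  ext x
  simp only [Set.mem_ofPred_eq, mem_sphere_iff_norm, sub_zero, Set.mem_inter_iff, Set.mem_preimage,
    Set.mem_compl_iff, not_exists, not_and]
  exact ⟨fun h v h1 h2 => h v h2 h1, fun h v h1 h2 => h v h2 h1⟩

theorem mem_chartDomain_iff {φ : A →L[ℂ] F} {x : X} :
    x ∈ chartDomain K φ ↔ ∀ v ∈ K x, ‖v‖ = 1 → v ∉ {v | φ v = 0} := by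
  refine ⟨fun h v hv h1 h0 => ?_, fun h v hv h0 => ?_⟩
  · rw [h v hv h0, norm_zero] at h1
    exact zero_ne_one h1
  · by_contra hne
    refine h (((‖v‖ : ℂ)⁻¹) • v) ((K x).smul_mem _ hv) ?_ ?_
    · rw [norm_smul, norm_inv, Complex.norm_real, norm_norm, inv_mul_cancel₀ (norm_ne_zero_iff.2 hne)]
    · simp [h0]

theorem isOpen_chartDomain (hK : IsClosed {p : X × A | p.2 ∈ K p.1}) (φ : A →L[ℂ] F) :
    IsOpen (chartDomain K φ) := by
  have := isOpen_setOf_forall_unit hK (isClosed_singleton.preimage φ.continuous : IsClosed (φ ⁻¹' {0}))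
  convert this using 1
  ext x
  exact mem_chartDomain_iff

/-- Compactness of the unit sphere turns injectivity of `φ` on `K x₀` into a lower bound that is
uniform near `x₀`. -/
theorem exists_lower_bound (hK : IsClosed {p : X × A | p.2 ∈ K p.1}) {φ : A →L[ℂ] F} {x₀ : X}
    (hx₀ : x₀ ∈ chartDomain K φ) :
    ∃ δ > 0, ∀ᶠ x in 𝓝 x₀, ∀ v ∈ K x, δ * ‖v‖ ≤ ‖φ v‖ := by
  have := FiniteDimensional.proper ℂ A
  have hc : IsCompact {v : A | v ∈ K x₀ ∧ ‖v‖ = 1} := by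
    have h1 : IsClosed {v : A | v ∈ K x₀} := hK.preimage (Continuous.prodMk_right x₀)
    have := (isCompact_sphere (0 : A) 1).inter_left h1
    convert this using 1
    ext v; simp
  obtain ⟨δ, hδ, h⟩ : ∃ δ > 0, ∀ v ∈ K x₀, ‖v‖ = 1 → δ < ‖φ v‖ := by
    rcases Set.eq_empty_or_nonempty {v : A | v ∈ K x₀ ∧ ‖v‖ = 1} with he | hne
    · refine ⟨1, one_pos, fun v h1 h2 => ?_⟩
      have : v ∈ {v : A | v ∈ K x₀ ∧ ‖v‖ = 1} := ⟨h1, h2⟩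
      simp [he] at this
    · obtain ⟨w, hw, hmin⟩ := hc.exists_isMinOn hne (φ.continuous.norm.continuousOn)
      have hpos : 0 < ‖φ w‖ := norm_pos_iff.2 (mem_chartDomain_iff.1 hx₀ w hw.1 hw.2)
      exact ⟨‖φ w‖ / 2, by positivity, fun v h1 h2 =>
        (half_lt_self hpos).trans_le (hmin (a := v) ⟨h1, h2⟩)⟩
  refine ⟨δ, hδ, ?_⟩
  have hcl : IsClosed {v : A | ‖φ v‖ ≤ δ} := isClosed_le φ.continuous.norm continuous_const
  filter_upwards [(isOpen_setOf_forall_unit hK hcl).mem_nhds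
    (show x₀ ∈ _ from fun v h1 h2 h3 => (h v h1 h2).not_ge h3)] with x hx v hv
  rcases eq_or_ne v 0 with rfl | hne
  · simp
  have hn : 0 < ‖v‖ := norm_pos_iff.2 hne
  have := hx (((‖v‖ : ℂ)⁻¹) • v) ((K x).smul_mem _ hv)
    (by rw [norm_smul, norm_inv, Complex.norm_real, norm_norm, inv_mul_cancel₀ hn.ne'])
  simp only [not_le, map_smul, norm_smul, norm_inv, Complex.norm_real, norm_norm] at this
  rw [inv_mul_eq_div, lt_div_iff₀ hn] at this
  exact this.le

section Bijective

variable [FiniteDimensional ℂ F] (hr : ∀ x, Module.finrank ℂ (K x) = Module.finrank ℂ F)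
include hr

theorem bijective_of_mem_chartDomain {φ : A →L[ℂ] F} {x : X} (hx : x ∈ chartDomain K φ) :
    Function.Bijective (fun v : K x => φ v) := by
  let ψ : K x →ₗ[ℂ] F := φ.toLinearMap ∘ₗ (K x).subtype
  have hinj : Function.Injective ψ := by
    rw [injective_iff_map_eq_zero]
    intro v hv
    exact Subtype.ext (hx v v.2 hv)
  exact ⟨hinj, (LinearMap.injective_iff_surjective_of_finrank_eq_finrank (hr x)).1 hinj⟩

theorem apply_chartInv {φ : A →L[ℂ] F} {x : X} (hx : x ∈ chartDomain K φ) (c : F) :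
    φ (chartInv K φ x c) = c :=
  Function.rightInverse_invFun (bijective_of_mem_chartDomain hr hx).2 c

theorem chartInv_apply {φ : A →L[ℂ] F} {x : X} (hx : x ∈ chartDomain K φ) (v : K x) :
    chartInv K φ x (φ v) = v :=
  Function.leftInverse_invFun (bijective_of_mem_chartDomain hr hx).1 v

/-- The inverse chart has a closed graph and is locally bounded, hence is continuous. -/
theorem continuousOn_chartInv (hK : IsClosed {p : X × A | p.2 ∈ K p.1}) (φ : A →L[ℂ] F) :
    ContinuousOn (fun p : X × F => (chartInv K φ p.1 p.2 : A)) (chartDomain K φ ×ˢ Set.univ) := by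
  have := FiniteDimensional.proper ℂ A
  rintro ⟨x₀, c₀⟩ ⟨hx₀, -⟩
  refine ContinuousAt.continuousWithinAt ?_
  obtain ⟨δ, hδ, hbd⟩ := exists_lower_bound hK hx₀
  intro O hO
  obtain ⟨O', hO', hOpen, hmem⟩ := mem_nhds_iff.1 hO
  set ρ := (‖c₀‖ + 1) / δ with hρ
  -- preimages of vectors near `c₀` stay in a fixed ball; those outside `O'` would accumulate at a
  -- second preimage of `c₀`
  have hcomp : IsCompact (Metric.closedBall (0 : A) ρ \ O') :=
    (isCompact_closedBall (0 : A) ρ).diff hOpen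
  have hC : IsClosed {q : (X × F) × A | q.2 ∈ K q.1.1 ∧ φ q.2 = q.1.2} :=
    (hK.preimage (f := fun q : (X × F) × A => (q.1.1, q.2)) (by fun_prop)).inter
      (isClosed_eq (by fun_prop) (by fun_prop))
  have hcl := (hcomp.isClosed_setOf_exists_mem hC).isOpen_compl
  have hin : (x₀, c₀) ∈ {p : X × F | ∃ v ∈ Metric.closedBall (0 : A) ρ \ O',
      (p, v) ∈ {q : (X × F) × A | q.2 ∈ K q.1.1 ∧ φ q.2 = q.1.2}}ᶜ := by
    rintro ⟨v, ⟨-, hv⟩, hv2, hv3⟩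
    apply hv
    have := chartInv_apply hr hx₀ ⟨v, hv2⟩
    simp only at hv3 this
    rw [hv3] at this
    rw [show v = ((⟨v, hv2⟩ : K x₀) : A) from rfl, ← this]
    exact hmem
  have h1 : ∀ᶠ p : X × F in 𝓝 (x₀, c₀), p.1 ∈ chartDomain K φ :=
    continuous_fst.continuousAt.eventually ((isOpen_chartDomain hK φ).mem_nhds hx₀)
  have h2 : ∀ᶠ p : X × F in 𝓝 (x₀, c₀), ‖p.2‖ < ‖c₀‖ + 1 :=
    (continuous_snd.norm.continuousAt (x := (x₀, c₀))).eventually_lt continuousAt_const (by simp)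
  have h3 := (continuous_fst (X := X) (Y := F)).continuousAt (x := (x₀, c₀)) |>.eventually hbd
  rw [Filter.mem_map]
  filter_upwards [hcl.mem_nhds hin, h1, h2, h3] with p hp h1 h2 h3
  refine hO' (by_contra fun hcon => ?_)
  refine hp ⟨chartInv K φ p.1 p.2, ⟨?_, hcon⟩, (chartInv K φ p.1 p.2).2, apply_chartInv hr h1 _⟩
  have := h3 _ (chartInv K φ p.1 p.2).2
  rw [apply_chartInv hr h1] at this
  rw [mem_closedBall_zero_iff, hρ, le_div_iff₀ hδ, mul_comm]
  exact this.trans h2.le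

end Bijective

end ClosedFamily

/-- The total space of a family of subspaces of a fixed space `A`, as a subspace of `X × A`. -/
abbrev subspaceTotalTopology {X : Type*} [TopologicalSpace X] {A : Type*} [NormedAddCommGroup A]
    [NormedSpace ℂ A] (F : Type*) (K : X → Submodule ℂ A) :
    TopologicalSpace (TotalSpace F (fun x => K x)) :=
  TopologicalSpace.induced (fun v => (v.1, (v.2 : A))) inferInstance

namespace ClosedFamily

variable {X : Type*} [TopologicalSpace X] {A : Type*} [NormedAddCommGroup A] [NormedSpace ℂ A]
  [FiniteDimensional ℂ A] {F : Type*} [NormedAddCommGroup F] [NormedSpace ℂ F]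
  [FiniteDimensional ℂ F] {K : X → Submodule ℂ A}
  (hK : IsClosed {p : X × A | p.2 ∈ K p.1})
  (hr : ∀ x, Module.finrank ℂ (K x) = Module.finrank ℂ F)

attribute [local instance] subspaceTotalTopology

/-- The local trivialization of a closed family of subspaces of constant dimension given by a
linear map on the ambient space. -/
noncomputable def trivialization (φ : A →L[ℂ] F) :
    Trivialization F (TotalSpace.proj (F := F) (E := fun x => K x)) where
  toFun v := (v.1, φ v.2)
  invFun p := ⟨p.1, chartInv K φ p.1 p.2⟩
  source := TotalSpace.proj ⁻¹' chartDomain K φ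
  target := chartDomain K φ ×ˢ Set.univ
  map_source' v hv := ⟨hv, Set.mem_univ _⟩
  map_target' p hp := hp.1
  left_inv' := fun ⟨x, v⟩ hv => congrArg (TotalSpace.mk x) (chartInv_apply hr hv v)
  right_inv' := fun ⟨x, c⟩ hp => congrArg (Prod.mk x) (apply_chartInv hr hp.1 c)
  open_source := (isOpen_chartDomain hK φ).preimage
    (continuous_fst.comp (continuous_induced_dom
      (f := fun v : TotalSpace F (fun x => K x) => (v.1, (v.2 : A)))))
  open_target := (isOpen_chartDomain hK φ).prod isOpen_univ
  continuousOn_toFun := Continuous.continuousOn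
    ((continuous_fst.prodMk (φ.continuous.comp continuous_snd)).comp
      (continuous_induced_dom (f := fun v : TotalSpace F (fun x => K x) => (v.1, (v.2 : A)))))
  continuousOn_invFun := by
    have hi : IsInducing (fun v : TotalSpace F (fun x => K x) => (v.1, (v.2 : A))) := ⟨rfl⟩
    rw [hi.continuousOn_iff]
    exact continuousOn_fst.prodMk (continuousOn_chartInv hr hK φ)
  baseSet := chartDomain K φ
  open_baseSet := isOpen_chartDomain hK φ
  source_eq := rfl
  target_eq := rfl
  proj_toFun _ _ := rfl

include hr in
theorem exists_mem_chartDomain (x : X) : ∃ φ : A →L[ℂ] F, x ∈ chartDomain K φ := by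
  -- any isomorphism of `K x` with `F`, extended linearly to `A`
  let e : K x ≃ₗ[ℂ] F := LinearEquiv.ofFinrankEq _ _ (hr x)
  obtain ⟨ψ, hψ⟩ := (e : K x →ₗ[ℂ] F).exists_extend
  refine ⟨LinearMap.toContinuousLinearMap ψ, fun v hv h0 => ?_⟩
  have : e ⟨v, hv⟩ = 0 := by
    rw [← LinearEquiv.coe_coe, ← hψ]
    exact h0
  simpa using this

/-- A closed family of subspaces of constant dimension in a finite-dimensional space is a fibre
bundle. -/
noncomputable abbrev fiberBundle : FiberBundle F (fun x => K x) where
  totalSpaceMk_isInducing' x := by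
    have hi : IsInducing (fun v : TotalSpace F (fun x => K x) => (v.1, (v.2 : A))) := ⟨rfl⟩
    rw [← hi.of_comp_iff]
    exact Topology.isInducing_const_prod.2 IsInducing.subtypeVal
  trivializationAtlas' := Set.range (trivialization hK hr)
  trivializationAt' x := trivialization hK hr (exists_mem_chartDomain hr x).choose
  mem_baseSet_trivializationAt' x := (exists_mem_chartDomain hr x).choose_spec
  trivialization_mem_atlas' x := Set.mem_range_self _

theorem vectorBundle : letI := fiberBundle hK hr; VectorBundle ℂ F (fun x => K x) := by
  let := fiberBundle hK hr
  have hlin : ∀ φ, (trivialization hK hr φ).IsLinear ℂ := fun φ =>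
    ⟨fun x _ => ⟨fun v w => map_add φ (v : A) w, fun c v => map_smul φ c (v : A)⟩⟩
  refine ⟨?_, ?_⟩
  · rintro _ ⟨φ, rfl⟩
    exact hlin φ
  · rintro _ _ ⟨φ, rfl⟩ ⟨ψ, rfl⟩
    have := hlin φ
    have := hlin ψ
    rw [continuousOn_clm_apply]
    intro c
    have h : ContinuousOn (fun x => ψ (chartInv K φ x c : A)) (chartDomain K φ) :=
      ψ.continuous.comp_continuousOn ((continuousOn_chartInv hr hK φ).comp
        (f := fun x => (x, c)) (by fun_prop) (fun x hx => ⟨hx, Set.mem_univ _⟩))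
    refine (h.mono Set.inter_subset_left).congr fun x hx => ?_
    exact Trivialization.coordChangeL_apply' _ _ hx c

end ClosedFamily

/-- The vector bundle formed by a closed family of subspaces of constant dimension. -/
noncomputable def ComplexVectorBundle.ofClosedFamily {X : Type*} [TopologicalSpace X] {A : Type}
    [NormedAddCommGroup A] [NormedSpace ℂ A] [FiniteDimensional ℂ A] {K : X → Submodule ℂ A} {r : ℕ}
    (hK : IsClosed {p : X × A | p.2 ∈ K p.1}) (hr : ∀ x, Module.finrank ℂ (K x) = r) :
    ComplexVectorBundle X :=
  have hr' : ∀ x, Module.finrank ℂ (K x) = Module.finrank ℂ (EuclideanSpace ℂ (Fin r)) :=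
    fun x => by rw [hr x, finrank_euclideanSpace_fin]
  letI := subspaceTotalTopology (EuclideanSpace ℂ (Fin r)) K
  letI := ClosedFamily.fiberBundle hK hr'
  haveI := ClosedFamily.vectorBundle hK hr'
  { rank := r
    Fiber := fun x => K x }

/-- A closed family of subspaces of constant dimension is a vector bundle, with the topology of its
total space inherited from the product with the ambient space. -/
theorem ComplexVectorBundle.exists_of_isClosed {X : Type*} [TopologicalSpace X] {A : Type}
    [NormedAddCommGroup A] [NormedSpace ℂ A] [FiniteDimensional ℂ A] {K : X → Submodule ℂ A} {r : ℕ}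
    (hK : IsClosed {p : X × A | p.2 ∈ K p.1}) (hr : ∀ x, Module.finrank ℂ (K x) = r) :
    ∃ (L : ComplexVectorBundle X) (e : ∀ x, L.Fiber x ≃ₗ[ℂ] K x),
      IsInducing fun v : TotalSpace L.Model L.Fiber => (v.1, (e v.1 v.2 : A)) :=
  ⟨ofClosedFamily hK hr, fun x => LinearEquiv.refl ℂ (K x), ⟨rfl⟩⟩

theorem ComplexVectorBundle.exists_trivial (X : Type*) [TopologicalSpace X] (N : ℕ) :
    ∃ (G : ComplexVectorBundle X) (e : ∀ x, G.Fiber x ≃ₗ[ℂ] EuclideanSpace ℂ (Fin N)),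
      IsInducing fun v : TotalSpace G.Model G.Fiber => (v.1, e v.1 v.2) :=
  ⟨{  rank := N
      Fiber := Bundle.Trivial X (EuclideanSpace ℂ (Fin N)) },
    fun _ => LinearEquiv.refl ℂ _, Bundle.Trivial.isInducing_toProd X (EuclideanSpace ℂ (Fin N))⟩

/-- Fibrewise isomorphisms between families embedded in product bundles give an isomorphism of
families as soon as they and their inverses are restrictions of continuous maps of the product
bundles. -/
theorem FamiliesIsomorphic.of_isInducing {X : Type*} [TopologicalSpace X] {F : Type*} {V : X → Type*}
    [∀ x, AddCommMonoid (V x)] [∀ x, Module ℂ (V x)] [TopologicalSpace (TotalSpace F V)]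
    {F' : Type*} {V' : X → Type*} [∀ x, AddCommMonoid (V' x)] [∀ x, Module ℂ (V' x)]
    [TopologicalSpace (TotalSpace F' V')] {A A' : Type*} [TopologicalSpace A] [TopologicalSpace A']
    (α : ∀ x, V x → A) (α' : ∀ x, V' x → A')
    (hα : IsInducing (fun v : TotalSpace F V => (v.1, α v.1 v.2)))
    (hα' : IsInducing (fun v : TotalSpace F' V' => (v.1, α' v.1 v.2)))
    (f : X → A → A') (hf : Continuous (fun p : X × A => f p.1 p.2))
    (f' : X → A' → A) (hf' : Continuous (fun p : X × A' => f' p.1 p.2))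
    (Φ : ∀ x, V x ≃ₗ[ℂ] V' x) (h : ∀ x v, α' x (Φ x v) = f x (α x v))
    (h' : ∀ x v, α x ((Φ x).symm v) = f' x (α' x v)) :
    FamiliesIsomorphic F V F' V' := by
  refine ⟨Φ, ?_⟩
  let e : TotalSpace F V ≃ TotalSpace F' V' :=
    { toFun := fun v => ⟨v.1, Φ v.1 v.2⟩
      invFun := fun v => ⟨v.1, (Φ v.1).symm v.2⟩
      left_inv := fun v => by simp
      right_inv := fun v => by simp }
  have h1 : Continuous e := by
    rw [hα'.continuous_iff]
    convert (continuous_fst.prodMk hf).comp hα.continuous using 1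
    funext v
    exact congrArg (Prod.mk v.1) (h v.1 v.2)
  have h2 : Continuous e.symm := by
    rw [hα.continuous_iff]
    convert (continuous_fst.prodMk hf').comp hα'.continuous using 1
    funext v
    exact congrArg (Prod.mk v.1) (h' v.1 v.2)
  exact (Homeomorph.mk e h1 h2).isHomeomorph

/-! ### The nonnegative spectral subspace of a diagonalizable operator with real eigenvalues -/

section Spectral

variable {W W' : Type*} [AddCommGroup W] [Module ℂ W] [AddCommGroup W'] [Module ℂ W']

theorem mem_nonnegSpectralSubspace_of_apply_eq {T : W →ₗ[ℂ] W} {μ : ℝ} (hμ : 0 ≤ μ) {v : W}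
    (hv : T v = (μ : ℂ) • v) : v ∈ nonnegSpectralSubspace T :=
  Submodule.mem_iSup_of_mem μ (Submodule.mem_iSup_of_mem hμ (Module.End.mem_eigenspace_iff.2 hv))

theorem map_nonnegSpectralSubspace_le {T : W →ₗ[ℂ] W} {T' : W' →ₗ[ℂ] W'} (R : W →ₗ[ℂ] W')
    (h : ∀ w, R (T w) = T' (R w)) :
    (nonnegSpectralSubspace T).map R ≤ nonnegSpectralSubspace T' := by
  rw [Submodule.map_le_iff_le_comap]
  refine iSup₂_le fun μ hμ v hv => ?_
  refine mem_nonnegSpectralSubspace_of_apply_eq hμ ?_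
  rw [← h, Module.End.mem_eigenspace_iff.1 hv, map_smul]

variable {ι : Type*} [Finite ι] {T : W →ₗ[ℂ] W} {b : Module.Basis ι ℂ W} {c : ι → ℝ}
  (hb : ∀ i, T (b i) = (c i : ℂ) • b i)
include hb

theorem repr_apply_of_eigenbasis (w : W) (i : ι) : b.repr (T w) i = c i * b.repr w i := by
  classical
  have h : b.coord i ∘ₗ T = (c i : ℂ) • b.coord i := by
    refine b.ext fun j => ?_
    by_cases hij : j = i
    · subst hij; simp [hb]
    · simp [hb, hij]
  exact LinearMap.congr_fun h w

/-- In terms of an eigenbasis, the nonnegative spectral subspace consists of the vectors with no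
component along the eigenvectors with negative eigenvalue. -/
theorem mem_nonnegSpectralSubspace_iff_repr {w : W} :
    w ∈ nonnegSpectralSubspace T ↔ ∀ i, c i < 0 → b.repr w i = 0 := by
  have := Fintype.ofFinite ι
  constructor
  · intro hw i hi
    suffices h : nonnegSpectralSubspace T ≤ LinearMap.ker (b.coord i) from h hw
    refine iSup₂_le fun μ hμ v hv => ?_
    have h1 := repr_apply_of_eigenbasis hb v i
    rw [Module.End.mem_eigenspace_iff.1 hv, map_smul, Finsupp.smul_apply, smul_eq_mul, ← sub_eq_zero,
      ← sub_mul] at h1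
    refine (mul_eq_zero.1 h1).resolve_left ?_
    have : c i - μ ≠ 0 := by linarith
    rw [← neg_sub, ← ne_eq, neg_ne_zero]
    exact_mod_cast this
  · intro h
    rw [← b.sum_repr w]
    refine Submodule.sum_mem _ fun i _ => ?_
    rcases lt_or_ge (c i) 0 with hi | hi
    · rw [h i hi, zero_smul]; exact zero_mem _
    · exact Submodule.smul_mem _ _ (mem_nonnegSpectralSubspace_of_apply_eq hi (hb i))

/-- An injective operator that anticommutes with some injective operator has as many positive as
negative eigenvalues. -/
theorem two_mul_finrank_nonnegSpectralSubspace [FiniteDimensional ℂ W]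
    (hT : Function.Injective T) {R : W →ₗ[ℂ] W} (hR : Function.Injective R)
    (hRT : ∀ w, R (T w) = -T (R w)) :
    2 * Module.finrank ℂ (nonnegSpectralSubspace T) = Module.finrank ℂ W := by
  have := Fintype.ofFinite ι
  have hb' : ∀ i, (-T) (b i) = ((-c i : ℝ) : ℂ) • b i := fun i => by simp [hb]
  have hc : ∀ i, c i ≠ 0 := fun i hi => by
    have h := hb i
    rw [hi, Complex.ofReal_zero, zero_smul] at h
    exact b.ne_zero i (hT (h.trans (map_zero T).symm))
  have hle : ∀ {P Q : Submodule ℂ W}, P.map R ≤ Q → Module.finrank ℂ P ≤ Module.finrank ℂ Q :=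
    fun {P Q} h => by
      rw [(P.equivMapOfInjective R hR).finrank_eq]
      exact Submodule.finrank_mono h
  have h1 : Module.finrank ℂ (nonnegSpectralSubspace T)
      = Module.finrank ℂ (nonnegSpectralSubspace (-T)) :=
    le_antisymm (hle (map_nonnegSpectralSubspace_le R hRT))
      (hle (map_nonnegSpectralSubspace_le R fun w => by simp [hRT]))
  have hinf : nonnegSpectralSubspace T ⊓ nonnegSpectralSubspace (-T) = ⊥ := by
    refine eq_bot_iff.2 fun w hw => ?_
    have h2 := (mem_nonnegSpectralSubspace_iff_repr hb).1 hw.1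
    have h3 := (mem_nonnegSpectralSubspace_iff_repr hb').1 hw.2
    refine (Submodule.mem_bot ℂ).2 (b.repr.map_eq_zero_iff.1 (Finsupp.ext fun i => ?_))
    rcases (hc i).lt_or_gt with hi | hi
    · exact h2 i hi
    · exact h3 i (by linarith)
  have hsup : nonnegSpectralSubspace T ⊔ nonnegSpectralSubspace (-T) = ⊤ := by
    refine eq_top_iff.2 fun w _ => ?_
    rw [← b.sum_repr w]
    refine Submodule.sum_mem _ fun i _ => Submodule.smul_mem _ _ ?_
    rcases le_total 0 (c i) with hi | hi
    · exact Submodule.mem_sup_left (mem_nonnegSpectralSubspace_of_apply_eq hi (hb i))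
    · exact Submodule.mem_sup_right
        (mem_nonnegSpectralSubspace_of_apply_eq (neg_nonneg.2 hi) (hb' i))
  have h4 := Submodule.finrank_sup_add_finrank_inf_eq (nonnegSpectralSubspace T)
    (nonnegSpectralSubspace (-T))
  rw [hinf, hsup, finrank_bot, finrank_top, ← h1] at h4
  omega

end Spectral

/-- The product of the operators `s T - (1 - s)` over the numbers `s` in a list. For `s ∈ (0, 1]`
such a factor vanishes at the nonnegative eigenvalue `(1 - s) / s` only, and every nonnegative
eigenvalue is of this form. -/
def affineProd {W : Type*} [AddCommGroup W] [Module ℂ W] (T : W →ₗ[ℂ] W) (s : List ℝ) :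
    W →ₗ[ℂ] W :=
  (s.map fun r : ℝ => (r : ℂ) • T - ((1 - r : ℝ) : ℂ) • (1 : W →ₗ[ℂ] W)).prod

theorem affineProd_cons {W : Type*} [AddCommGroup W] [Module ℂ W] (T : W →ₗ[ℂ] W) (r : ℝ)
    (s : List ℝ) (w : W) : affineProd T (r :: s) w =
      (r : ℂ) • T (affineProd T s w) - ((1 - r : ℝ) : ℂ) • affineProd T s w := by
  simp only [affineProd, List.map_cons, List.prod_cons]
  rfl

theorem map_affineProd {W W' : Type*} [AddCommGroup W] [Module ℂ W] [AddCommGroup W'] [Module ℂ W']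
    {T : W →ₗ[ℂ] W} {T' : W' →ₗ[ℂ] W'} (R : W →ₗ[ℂ] W') (h : ∀ w, R (T w) = T' (R w))
    (s : List ℝ) (w : W) : R (affineProd T s w) = affineProd T' s (R w) := by
  induction s with
  | nil => rfl
  | cons r s ih => rw [affineProd_cons, affineProd_cons, map_sub, map_smul, map_smul, h, ih]

section Closed

variable {W : Type*} [AddCommGroup W] [Module ℂ W] {k : ℕ} {T : W →ₗ[ℂ] W}
  {b : Module.Basis (Fin k) ℂ W} {c : Fin k → ℝ} (hb : ∀ i, T (b i) = (c i : ℂ) • b i)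
include hb

theorem repr_affineProd (s : List ℝ) (w : W) (i : Fin k) :
    b.repr (affineProd T s w) i =
      ((s.map fun r => r * c i - (1 - r)).prod : ℝ) * b.repr w i := by
  induction s with
  | nil => simp [affineProd]
  | cons r s ih =>
    rw [affineProd_cons, map_sub, map_smul, map_smul, Finsupp.sub_apply, Finsupp.smul_apply,
      Finsupp.smul_apply, repr_apply_of_eigenbasis hb, ih]
    simp only [smul_eq_mul, List.map_cons, List.prod_cons]
    push_cast
    ring

/-- A characterization of the nonnegative spectral subspace which is closed under limits, since
the parameters `s` range over a compact set. -/
theorem mem_nonnegSpectralSubspace_iff_affineProd {w : W} :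
    w ∈ nonnegSpectralSubspace T ↔
      ∃ s ∈ Set.Icc (0 : Fin k → ℝ) 1, affineProd T (List.ofFn s) w = 0 := by
  rw [mem_nonnegSpectralSubspace_iff_repr hb]
  constructor
  · intro h
    -- the factor with `s = 1 / (1 + c)` kills the eigenvalue `c`, that with `s = 0` is `-1`
    refine ⟨fun i => if 0 ≤ c i then 1 / (1 + c i) else 0, ⟨fun i => ?_, fun i => ?_⟩, ?_⟩
    · dsimp only [Pi.zero_apply]
      split_ifs <;> positivity
    · dsimp only [Pi.one_apply]
      split_ifs with hi
      · rw [div_le_one (by linarith)]; linarith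
      · exact zero_le_one
    · refine b.repr.map_eq_zero_iff.1 (Finsupp.ext fun i => ?_)
      rw [repr_affineProd hb]
      rcases lt_or_ge (c i) 0 with hi | hi
      · rw [h i hi, mul_zero]; rfl
      · rw [List.map_ofFn, List.prod_eq_zero, Complex.ofReal_zero, zero_mul]; · rfl
        rw [List.mem_ofFn]
        refine ⟨i, ?_⟩
        simp only [Function.comp, if_pos hi]
        have : 1 + c i ≠ 0 := by linarith
        field_simp
        ring
  · rintro ⟨s, hs, h0⟩ i hi
    have h := repr_affineProd hb (List.ofFn s) w i
    rw [h0, map_zero, Finsupp.zero_apply] at h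
    refine (mul_eq_zero.1 h.symm).resolve_left ?_
    rw [← ne_eq, Complex.ofReal_ne_zero, List.map_ofFn]
    refine List.prod_ne_zero fun hmem => ?_
    obtain ⟨j, hj⟩ := List.mem_ofFn.1 hmem
    have h1 : 0 ≤ s j := hs.1 j
    have h2 : s j ≤ 1 := hs.2 j
    simp only [Function.comp] at hj
    rcases h1.eq_or_lt with h3 | h3
    · rw [← h3] at hj; norm_num at hj
    · nlinarith [mul_neg_of_pos_of_neg h3 hi]

end Closed

/-- The nonnegative spectral subspaces of a continuous family of diagonalizable operators with real
eigenvalues form a closed family. The operators `T x` act in the fibres `W x` of a bundle, which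
are embedded by `j x` in a fixed space `A`, and continuity is that of the operators `j x ∘ T x ∘ l x`
on `A`. -/
theorem isClosed_map_nonnegSpectralSubspace {X : Type*} [TopologicalSpace X] {A : Type*}
    [NormedAddCommGroup A] [NormedSpace ℂ A] {W : X → Type*} [∀ x, AddCommGroup (W x)]
    [∀ x, Module ℂ (W x)] (T : ∀ x, W x →ₗ[ℂ] W x) (j : ∀ x, W x →ₗ[ℂ] A) (l : ∀ x, A →ₗ[ℂ] W x)
    (hlj : ∀ x w, l x (j x w) = w)
    (hT : Continuous fun p : X × A => j p.1 (T p.1 (l p.1 p.2)))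
    (hQ : Continuous fun p : X × A => j p.1 (l p.1 p.2)) {k : ℕ}
    (hdiag : ∀ x, ∃ (b : Module.Basis (Fin k) ℂ (W x)) (c : Fin k → ℝ),
      ∀ i, T x (b i) = (c i : ℂ) • b i) :
    IsClosed {p : X × A | p.2 ∈ (nonnegSpectralSubspace (T p.1)).map (j p.1)} := by
  -- `j x` intertwines `T x` with the operator `B x` of the fixed space `A`
  let B : ∀ x, A →ₗ[ℂ] A := fun x => j x ∘ₗ T x ∘ₗ l x
  have hcont : ∀ m : ℕ, Continuous fun q : (X × A) × (Fin m → ℝ) =>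
      affineProd (B q.1.1) (List.ofFn q.2) q.1.2 := by
    intro m
    induction m with
    | zero => simpa [affineProd] using continuous_fst.snd
    | succ m ih =>
      simp only [List.ofFn_succ, affineProd_cons]
      have h1 : Continuous fun q : (X × A) × (Fin (m + 1) → ℝ) =>
          affineProd (B q.1.1) (List.ofFn fun i => q.2 i.succ) q.1.2 :=
        ih.comp (f := fun q : (X × A) × (Fin (m + 1) → ℝ) => (q.1, fun i : Fin m => q.2 i.succ))
          (by fun_prop)
      have h2 : Continuous fun q : (X × A) × (Fin (m + 1) → ℝ) => B q.1.1
          (affineProd (B q.1.1) (List.ofFn fun i => q.2 i.succ) q.1.2) :=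
        hT.comp (continuous_fst.fst.prodMk h1)
      exact ((Complex.continuous_ofReal.comp (by fun_prop)).smul h2).sub
        ((Complex.continuous_ofReal.comp (by fun_prop)).smul h1)
  have hcl := (isCompact_Icc (a := (0 : Fin k → ℝ)) (b := 1)).isClosed_setOf_exists_mem
    (isClosed_eq (hcont k) continuous_const : IsClosed {q | _ = (0 : A)})
  convert (isClosed_eq hQ continuous_snd).inter hcl using 1
  ext ⟨x, a⟩
  have hcomm : ∀ w, j x (T x w) = B x (j x w) := fun w => by simp [B, hlj]
  obtain ⟨b, c, hb⟩ := hdiag x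
  simp only [Submodule.mem_map, Set.mem_inter_iff, Set.mem_ofPred_eq]
  constructor
  · rintro ⟨w, hw, hwa⟩
    obtain rfl : j x w = a := hwa
    rw [mem_nonnegSpectralSubspace_iff_affineProd hb] at hw
    obtain ⟨s, hs, h0⟩ := hw
    refine ⟨by rw [hlj], s, hs, ?_⟩
    rw [← map_affineProd (j x) hcomm, h0, map_zero]
  · rintro ⟨h1, s, hs, h0⟩
    refine ⟨l x a, (mem_nonnegSpectralSubspace_iff_affineProd hb).2 ⟨s, hs, ?_⟩, h1⟩
    rw [← h1, ← map_affineProd (j x) hcomm] at h0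
    rw [← hlj x (affineProd _ _ _), h0, map_zero]

/-! ### The block operator of a cross product -/

section Block

variable {V : Type*} [NormedAddCommGroup V] [InnerProductSpace ℂ V] [FiniteDimensional ℂ V]
  [CompleteSpace V] {a d : V →L[ℂ] V}

open ContinuousLinearMap (adjoint)

theorem blockOperator_apply {V : Type*} [NormedAddCommGroup V] [NormedSpace ℂ V]
    (a b c d : V →L[ℂ] V) (w : V × V) : blockOperator a b c d w = (a w.1 + b w.2, c w.1 + d w.2) :=
  rfl

/-- The block operator is symmetric for the Hilbert sum `WithLp 2 (V × V)`. -/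
theorem blockOperator_diagonalizable (ha : IsSelfAdjoint a) {k : ℕ}
    (hk : Module.finrank ℂ (V × V) = k) :
    ∃ (b : Module.Basis (Fin k) ℂ (V × V)) (c : Fin k → ℝ),
      ∀ i, blockOperator a (adjoint d) d (-a) (b i) = (c i : ℂ) • b i := by
  let e : WithLp 2 (V × V) ≃ₗ[ℂ] V × V := WithLp.linearEquiv 2 ℂ (V × V)
  let S : WithLp 2 (V × V) →ₗ[ℂ] WithLp 2 (V × V) :=
    e.symm.toLinearMap ∘ₗ (blockOperator a (adjoint d) d (-a)).toLinearMap ∘ₗ e.toLinearMap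
  have hsym : ∀ u v : V, inner ℂ (a u) v = inner ℂ u (a v) := fun u v => by
    conv_lhs => rw [← ha.adjoint_eq, ContinuousLinearMap.adjoint_inner_left]
  have hS : S.IsSymmetric := by
    intro u v
    simp only [WithLp.prod_inner_apply]
    change inner ℂ (a u.fst + adjoint d u.snd) v.fst + inner ℂ (d u.fst + -a u.snd) v.snd
      = inner ℂ u.fst (a v.fst + adjoint d v.snd) + inner ℂ u.snd (d v.fst + -a v.snd)
    simp only [inner_add_left, inner_add_right, inner_neg_left, inner_neg_right, hsym,
      ContinuousLinearMap.adjoint_inner_left, ContinuousLinearMap.adjoint_inner_right]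
    ring
  have hk' : Module.finrank ℂ (WithLp 2 (V × V)) = k := by rw [LinearEquiv.finrank_eq e, hk]
  refine ⟨(hS.eigenvectorBasis hk').toBasis.map e, hS.eigenvalues hk', fun i => ?_⟩
  have h := congrArg e (hS.apply_eigenvectorBasis hk' i)
  rw [map_smul] at h
  exact h

theorem blockOperator_injective (ha : IsSelfAdjoint a) (hcomm : ∀ v, a (d v) = d (a v))
    (hbij : Function.Bijective a ∨ Function.Bijective d) :
    Function.Injective (blockOperator a (adjoint d) d (-a)) := by
  have hsym : ∀ u v : V, inner ℂ (a u) v = inner ℂ u (a v) := fun u v => by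
    conv_lhs => rw [← ha.adjoint_eq, ContinuousLinearMap.adjoint_inner_left]
  rw [injective_iff_map_eq_zero]
  rintro ⟨u, v⟩ h
  simp only [blockOperator_apply, Prod.mk_eq_zero, neg_apply] at h
  obtain ⟨h1, h2⟩ := h
  -- `‖a u‖² + ‖d u‖² = 0`, because `d u = a v` and `a u + d† v = 0`
  have h3 : inner ℂ (a u) (a u) + inner ℂ (d u) (d u) = (0 : ℂ) := by
    have : d u = a v := by rwa [add_neg_eq_zero] at h2
    have h4 : inner ℂ (d u) (d u) = inner ℂ (a u) (adjoint d v) := by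
      rw [ContinuousLinearMap.adjoint_inner_right, ← hcomm, hsym, ← this]
    rw [h4, ← inner_add_right, h1, inner_zero_right]
  have h5 : a u = 0 ∧ d u = 0 := by
    rw [inner_self_eq_norm_sq_to_K, inner_self_eq_norm_sq_to_K] at h3
    have h6 : ‖a u‖ ^ 2 + ‖d u‖ ^ 2 = 0 := Complex.ofReal_injective (by simpa using h3)
    constructor <;> rw [← norm_eq_zero] <;> nlinarith [sq_nonneg ‖a u‖, sq_nonneg ‖d u‖]
  have hu : u = 0 := by
    rcases hbij with hb | hb
    · exact hb.1 (by rw [h5.1, map_zero])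
    · exact hb.1 (by rw [h5.2, map_zero])
  rw [hu, map_zero, zero_add] at h1 h2
  refine Prod.mk_eq_zero.2 ⟨hu, ?_⟩
  rcases hbij with hb | hb
  · exact hb.1 (by rw [neg_eq_zero.1 h2, map_zero])
  · obtain ⟨z, rfl⟩ := hb.2 v
    rw [← inner_self_eq_zero (𝕜 := ℂ), ← ContinuousLinearMap.adjoint_inner_right, h1,
      inner_zero_right]

/-- The operator `(0, -d†; d, 0)` anticommutes with the block operator, and so does `(0, -1; 1, 0)`
when `d = 0`; hence half of the eigenvalues are positive. -/
theorem finrank_nonnegSpectralSubspace_blockOperator (ha : IsSelfAdjoint a)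
    (hcomm : ∀ v, a (d v) = d (a v))
    (hbij : Function.Bijective a ∧ d = 0 ∨ Function.Bijective d) :
    Module.finrank ℂ (nonnegSpectralSubspace
      (blockOperator a (adjoint d) d (-a) : V × V →ₗ[ℂ] V × V)) = Module.finrank ℂ V := by
  obtain ⟨b, c, hb⟩ := blockOperator_diagonalizable (d := d) ha rfl
  have hT := blockOperator_injective ha hcomm (hbij.imp_left And.left)
  have hcomm' : ∀ v, a (adjoint d v) = adjoint d (a v) := fun v => by
    have h : a ∘L d = d ∘L a := ContinuousLinearMap.ext hcomm
    have h2 := congrArg adjoint h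
    rw [ContinuousLinearMap.adjoint_comp, ContinuousLinearMap.adjoint_comp, ha.adjoint_eq] at h2
    exact (DFunLike.congr_fun h2 v).symm
  obtain ⟨R, hR, hRT⟩ : ∃ R : V × V →ₗ[ℂ] V × V, Function.Injective R ∧
      ∀ w, R (blockOperator a (adjoint d) d (-a) w) = -blockOperator a (adjoint d) d (-a) (R w) := by
    rcases hbij with ⟨hba, rfl⟩ | hbd
    · refine ⟨(blockOperator 0 (-1) 1 0 : V × V →L[ℂ] V × V), ?_, ?_⟩
      · rw [injective_iff_map_eq_zero]
        rintro ⟨u, v⟩ h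
        simpa [blockOperator_apply, and_comm] using h
      · rintro ⟨u, v⟩
        simp [blockOperator_apply]
    · refine ⟨(blockOperator 0 (-adjoint d) d 0 : V × V →L[ℂ] V × V), ?_, ?_⟩
      · rw [injective_iff_map_eq_zero]
        rintro ⟨u, v⟩ h
        simp only [ContinuousLinearMap.coe_coe, blockOperator_apply, Prod.mk_eq_zero,
          zero_apply, zero_add, add_zero, neg_apply, neg_eq_zero] at h
        have hu : u = 0 := hbd.1 (by rw [h.2, map_zero])
        obtain ⟨z, rfl⟩ := hbd.2 v
        rw [Prod.mk_eq_zero, ← inner_self_eq_zero (𝕜 := ℂ) (x := d z),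
          ← ContinuousLinearMap.adjoint_inner_right, h.1, inner_zero_right]
        exact ⟨hu, rfl⟩
      · rintro ⟨u, v⟩
        simp only [ContinuousLinearMap.coe_coe, blockOperator_apply,
          zero_apply, zero_add, add_zero, neg_apply,
          Prod.neg_mk, map_add, map_neg, hcomm, hcomm', Prod.mk.injEq]
        constructor <;> abel
  have h := two_mul_finrank_nonnegSpectralSubspace hb hT hR hRT
  rw [Module.finrank_prod] at h
  omega

end Block

/-! ### Embedding a vector bundle over a compact space into a trivial bundle -/

section Embedding

/-- A finite partition of unity by squares, subordinate to a cover. -/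
theorem exists_finite_sq_partition {M : Type*} [TopologicalSpace M] [T2Space M] [CompactSpace M]
    (U : M → Set M) (hU : ∀ x, IsOpen (U x)) (hmem : ∀ x, x ∈ U x) :
    ∃ (n : ℕ) (p : Fin n → M) (θ : Fin n → M → ℝ), (∀ i, Continuous (θ i)) ∧
      (∀ i, tsupport (θ i) ⊆ U (p i)) ∧ ∀ x, ∑ i, θ i x ^ 2 = 1 := by
  obtain ⟨t, ht⟩ := isCompact_univ.elim_finite_subcover U hU
    fun x _ => Set.mem_iUnion.2 ⟨x, hmem x⟩
  let p : Fin t.card → M := fun i => (t.equivFin.symm i : M)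
  have hcov : (Set.univ : Set M) ⊆ ⋃ i, U (p i) := fun x hx => by
    obtain ⟨y, hy, hxy⟩ := Set.mem_iUnion₂.1 (ht hx)
    exact Set.mem_iUnion.2 ⟨t.equivFin ⟨y, hy⟩, by simpa [p] using hxy⟩
  obtain ⟨ρ, hρ⟩ := PartitionOfUnity.exists_isSubordinate isClosed_univ (fun i => U (p i))
    (fun i => hU _) hcov
  refine ⟨t.card, p, fun i x => √(ρ i x), fun i => (ρ i).continuous.sqrt, fun i => ?_, fun x => ?_⟩
  · refine (closure_mono fun x hx => ?_).trans (hρ i)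
    intro h0
    exact hx (by simp only [h0, Real.sqrt_zero])
  · rw [← ρ.sum_eq_one (Set.mem_univ x), finsum_eq_sum_of_fintype]
    exact Finset.sum_congr rfl fun i _ => Real.sq_sqrt (ρ.nonneg i x)

variable {𝕜 : Type*} [RCLike 𝕜] {M : Type*} [TopologicalSpace M]
  {F : Type*} [NormedAddCommGroup F] [NormedSpace 𝕜 F]
  {E : M → Type*} [∀ x, AddCommGroup (E x)] [∀ x, Module 𝕜 (E x)] [∀ x, TopologicalSpace (E x)]
  [TopologicalSpace (TotalSpace F E)] [FiberBundle F E] [VectorBundle 𝕜 F E]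

variable (𝕜 F E) in
/-- An embedding of a vector bundle `E` over `M` into the trivial bundle with fibre `A`, together
with a left inverse; both are continuous bundle maps. -/
structure TrivialEmbedding (A : Type*) [NormedAddCommGroup A] [NormedSpace 𝕜 A] where
  /-- The embedding of the fibres. -/
  emb : ∀ x, E x →L[𝕜] A
  /-- The left inverse of the embedding. -/
  ret : ∀ x, A →L[𝕜] E x
  ret_emb : ∀ x v, ret x (emb x v) = v
  continuous_emb : Continuous fun v : TotalSpace F E => emb v.1 v.2
  continuous_ret : Continuous fun p : M × A => (⟨p.1, ret p.1 p.2⟩ : TotalSpace F E)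

theorem continuous_smul_trivialization (e : Trivialization F (TotalSpace.proj (F := F) (E := E)))
    [e.IsLinear 𝕜] {θ : M → ℝ} (hθ : Continuous θ) (hs : tsupport θ ⊆ e.baseSet) :
    Continuous fun v : TotalSpace F E => (θ v.1 : 𝕜) • e.continuousLinearMapAt 𝕜 v.1 v.2 := by
  have hproj := FiberBundle.continuous_proj F E
  refine continuous_iff_continuousAt.2 fun v => ?_
  by_cases hv : v.1 ∈ tsupport θ
  · have h1 : ContinuousAt (fun v : TotalSpace F E => (θ v.1 : 𝕜) • (e v).2) v :=
      ((RCLike.continuous_ofReal.comp (hθ.comp hproj)).continuousAt).smul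
        (continuous_snd.continuousAt.comp (e.continuousAt (e.mem_source.2 (hs hv))))
    refine h1.congr ?_
    filter_upwards [hproj.continuousAt.eventually (e.open_baseSet.mem_nhds (hs hv))] with w hw
    rw [e.continuousLinearMapAt_apply 𝕜, e.coe_linearMapAt_of_mem hw]
  · refine (continuousAt_const (y := (0 : F))).congr ?_
    filter_upwards [hproj.continuousAt.eventually
      ((isClosed_tsupport θ).isOpen_compl.mem_nhds hv)] with w hw
    rw [image_eq_zero_of_notMem_tsupport hw, RCLike.ofReal_zero, zero_smul]

theorem continuousAt_smul_coordChange (e e' : Trivialization F (TotalSpace.proj (F := F) (E := E)))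
    [MemTrivializationAtlas e] [MemTrivializationAtlas e'] {θ : M → ℝ} (hθ : Continuous θ)
    (hs : tsupport θ ⊆ e.baseSet) {x₀ : M} (hx₀ : x₀ ∈ e'.baseSet) (c₀ : F) :
    ContinuousAt (fun p : M × F =>
      (θ p.1 : 𝕜) • e'.continuousLinearMapAt 𝕜 p.1 (e.symmL 𝕜 p.1 p.2)) (x₀, c₀) := by
  by_cases hv : x₀ ∈ tsupport θ
  · have hmem := (e.open_baseSet.inter e'.open_baseSet).mem_nhds ⟨hs hv, hx₀⟩
    have h1 : ContinuousAt (fun p : M × F =>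
        (θ p.1 : 𝕜) • (e.coordChangeL 𝕜 e' p.1 : F →L[𝕜] F) p.2) (x₀, c₀) :=
      (RCLike.continuous_ofReal.comp (hθ.comp continuous_fst)).continuousAt.smul
        ((((continuousOn_coordChange 𝕜 e e').continuousAt hmem).comp
          (f := Prod.fst) (x := (x₀, c₀)) continuousAt_fst).clm_apply continuousAt_snd)
    refine h1.congr ?_
    filter_upwards [continuousAt_fst.eventually hmem] with p hp
    rw [ContinuousLinearEquiv.coe_coe, e.coordChangeL_apply e' hp, e'.continuousLinearMapAt_apply 𝕜,
      e'.coe_linearMapAt_of_mem hp.2, e.symmL_apply hp.1]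
  · refine (continuousAt_const (y := (0 : F))).congr ?_
    filter_upwards [(continuousAt_fst (p := (x₀, c₀))).eventually
      ((isClosed_tsupport θ).isOpen_compl.mem_nhds hv)] with w hw
    rw [image_eq_zero_of_notMem_tsupport hw, RCLike.ofReal_zero, zero_smul]

variable (𝕜 F E) in
/-- Local trivializations `eᵢ` with functions `θᵢ` supported in their domains and `∑ θᵢ² = 1` give
the embedding `v ↦ (θᵢ eᵢ v)ᵢ` with left inverse `(cᵢ)ᵢ ↦ ∑ θᵢ eᵢ⁻¹ cᵢ`. -/
theorem TrivialEmbedding.exists [T2Space M] [CompactSpace M] [FiniteDimensional 𝕜 F]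
    [∀ x, IsTopologicalAddGroup (E x)] [∀ x, ContinuousSMul 𝕜 (E x)] :
    ∃ N : ℕ, Nonempty (TrivialEmbedding 𝕜 F E (EuclideanSpace 𝕜 (Fin N))) := by
  obtain ⟨n, p, θ, hθ, hs, hsum⟩ := exists_finite_sq_partition
    (fun x => (FiberBundle.trivializationAt F E x).baseSet)
    (fun x => (FiberBundle.trivializationAt F E x).open_baseSet)
    (fun x => FiberBundle.mem_baseSet_trivializationAt F E x)
  let e := fun i => FiberBundle.trivializationAt F E (p i)
  let g : (Fin n → F) ≃L[𝕜] EuclideanSpace 𝕜 (Fin (Module.finrank 𝕜 (Fin n → F))) :=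
    ContinuousLinearEquiv.ofFinrankEq (by simp)
  refine ⟨Module.finrank 𝕜 (Fin n → F), ⟨{
    emb := fun x => (g : (Fin n → F) →L[𝕜] _).comp
      (ContinuousLinearMap.pi fun i => (θ i x : 𝕜) • (e i).continuousLinearMapAt 𝕜 x)
    ret := fun x => (∑ i, ((θ i x : 𝕜) • (e i).symmL 𝕜 x).comp
      (ContinuousLinearMap.proj (R := 𝕜) (φ := fun _ : Fin n => F) i)).comp
        (g.symm : EuclideanSpace 𝕜 _ →L[𝕜] (Fin n → F))
    ret_emb := fun x v => ?_
    continuous_emb := ?_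
    continuous_ret := ?_ }⟩⟩
  · have h : ∀ i, (θ i x : 𝕜) • (e i).symmL 𝕜 x ((θ i x : 𝕜) • (e i).continuousLinearMapAt 𝕜 x v)
        = ((θ i x ^ 2 : ℝ) : 𝕜) • v := fun i => by
      by_cases hx : x ∈ (e i).baseSet
      · rw [map_smul, (e i).symmL_continuousLinearMapAt hx, smul_smul]
        push_cast
        rw [sq]
      · rw [image_eq_zero_of_notMem_tsupport fun h => hx (hs i h)]
        simp
    simp only [ContinuousLinearMap.comp_apply, sum_apply,
      smul_apply, ContinuousLinearMap.proj_apply, ContinuousLinearEquiv.coe_coe,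
      ContinuousLinearEquiv.symm_apply_apply, ContinuousLinearMap.pi_apply, h]
    rw [← Finset.sum_smul, ← RCLike.ofReal_sum, hsum, RCLike.ofReal_one, one_smul]
  · exact g.continuous.comp (continuous_pi fun i => continuous_smul_trivialization (e i) (hθ i) (hs i))
  · refine continuous_iff_continuousAt.2 fun q₀ => ?_
    rw [FiberBundle.continuousAt_totalSpace]
    refine ⟨continuousAt_fst, ?_⟩
    let e₀ := FiberBundle.trivializationAt F E q₀.1
    have hq₀ : q₀.1 ∈ e₀.baseSet := FiberBundle.mem_baseSet_trivializationAt F E q₀.1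
    have h1 : ContinuousAt (fun q : M × EuclideanSpace 𝕜 (Fin (Module.finrank 𝕜 (Fin n → F))) =>
        ∑ i, (θ i q.1 : 𝕜) • e₀.continuousLinearMapAt 𝕜 q.1 ((e i).symmL 𝕜 q.1 (g.symm q.2 i)))
        q₀ := by
      refine tendsto_finsetSum _ fun i _ => ?_
      exact (continuousAt_smul_coordChange (e i) e₀ (hθ i) (hs i) hq₀ (g.symm q₀.2 i)).comp
        (f := fun q : M × EuclideanSpace 𝕜 (Fin (Module.finrank 𝕜 (Fin n → F))) =>
          (q.1, g.symm q.2 i)) (by fun_prop)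
    refine h1.congr ?_
    filter_upwards [continuousAt_fst.eventually (e₀.open_baseSet.mem_nhds hq₀)] with q hq
    have h2 : (e₀ ⟨q.1, (∑ i, ((θ i q.1 : 𝕜) • (e i).symmL 𝕜 q.1).comp
        (ContinuousLinearMap.proj (R := 𝕜) (φ := fun _ : Fin n => F) i)) (g.symm q.2)⟩).2 =
        e₀.continuousLinearMapAt 𝕜 q.1 ((∑ i, ((θ i q.1 : 𝕜) • (e i).symmL 𝕜 q.1).comp
        (ContinuousLinearMap.proj (R := 𝕜) (φ := fun _ : Fin n => F) i)) (g.symm q.2)) := by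
      rw [e₀.continuousLinearMapAt_apply 𝕜, e₀.coe_linearMapAt_of_mem hq]
    refine Eq.trans ?_ h2.symm
    simp only [sum_apply, map_sum, ContinuousLinearMap.comp_apply,
      smul_apply, map_smul, ContinuousLinearMap.proj_apply]

namespace TrivialEmbedding

variable {A : Type*} [NormedAddCommGroup A] [NormedSpace 𝕜 A] (t : TrivialEmbedding 𝕜 F E A)

theorem emb_injective (x : M) : Function.Injective (t.emb x) :=
  Function.LeftInverse.injective (t.ret_emb x)

theorem isInducing : IsInducing fun v : TotalSpace F E => (v.1, t.emb v.1 v.2) := by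
  refine IsInducing.of_comp (g := fun p : M × A => (⟨p.1, t.ret p.1 p.2⟩ : TotalSpace F E))
    ((FiberBundle.continuous_proj F E).prodMk t.continuous_emb) t.continuous_ret ?_
  convert IsInducing.id (X := TotalSpace F E) using 1
  funext v
  exact congrArg (TotalSpace.mk v.1) (t.ret_emb v.1 v.2)

theorem continuous_ret_comp {X : Type*} [TopologicalSpace X] {f : X → M} {h : X → A}
    (hf : Continuous f) (hh : Continuous h) :
    Continuous fun x => (⟨f x, t.ret (f x) (h x)⟩ : TotalSpace F E) :=
  t.continuous_ret.comp (hf.prodMk hh)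

end TrivialEmbedding

end Embedding

/-! ### Continuity of symbols and of the operations on covectors -/

section CotangentContinuity

variable {B : Type*} [NormedAddCommGroup B] [NormedSpace ℝ B] {H : Type*} [TopologicalSpace H]
  {I : ModelWithCorners ℝ B H} {M : Type*} [TopologicalSpace M] [ChartedSpace H M]
  [IsManifold I 1 M] {A' : Type*} [NormedAddCommGroup A'] [NormedSpace ℝ A']
  (tT : TrivialEmbedding ℝ (B →L[ℝ] ℝ) (fun x : M => CotangentSpace I x) A')

theorem CosphereBundle.snd_ne_zero {g : CotangentMetric I M} (ξ : CosphereBundle g) :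
    ξ.1.2 ≠ 0 := fun h0 => by
  have h := ξ.2
  rw [h0] at h
  simp at h

include tT in
theorem CosphereBundle.continuous_antipode {g : CotangentMetric I M} :
    Continuous (CosphereBundle.antipode : CosphereBundle g → CosphereBundle g) := by
  refine Continuous.subtype_mk ?_ _
  have h := tT.continuous_ret_comp (f := fun ξ : CosphereBundle g => ξ.1.1)
    (h := fun ξ => -tT.emb ξ.1.1 ξ.1.2) (CosphereBundle.proj g).continuous
    (tT.continuous_emb.comp continuous_subtype_val).neg
  convert h using 1
  funext ξ
  rw [map_neg, tT.ret_emb]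

include tT in
/-- The projection `S*M → P*M` is open, as the quotient by a finite group of homeomorphisms. -/
theorem CosphereBundle.isOpenQuotientMap_toProj (g : CotangentMetric I M) :
    IsOpenQuotientMap (CosphereBundle.toProj g) := by
  refine ⟨Quotient.mk_surjective, (CosphereBundle.toProj g).continuous, fun U hU => ?_⟩
  rw [← isQuotientMap_quotient_mk'.isOpen_preimage]
  convert hU.union (hU.preimage (CosphereBundle.continuous_antipode tT)) using 1
  ext ξ
  constructor
  · rintro ⟨η, hη, h⟩
    rcases Quotient.exact h with rfl | rfl
    · exact Or.inl hη
    · right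
      rw [Set.mem_preimage, CosphereBundle.antipode_antipode]
      exact hη
  · rintro (h | h)
    · exact ⟨ξ, h, rfl⟩
    · exact ⟨ξ.antipode, h, Quotient.sound (Or.inr (CosphereBundle.antipode_antipode ξ).symm)⟩

/-- The cosphere bundle defined by the norm of the trivial bundle is compact. -/
theorem isCompact_norm_emb_eq_one [CompactSpace M] [FiniteDimensional ℝ A'] :
    IsCompact {ξ : CotangentBundle I M | ‖tT.emb ξ.1 ξ.2‖ = 1} := by
  have := FiniteDimensional.proper ℝ A'
  have h : IsCompact {p : M × A' | tT.emb p.1 (tT.ret p.1 p.2) = p.2 ∧ ‖p.2‖ = 1} := by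
    have h1 : IsClosed {p : M × A' | tT.emb p.1 (tT.ret p.1 p.2) = p.2} :=
      isClosed_eq (tT.continuous_emb.comp tT.continuous_ret) continuous_snd
    convert (isCompact_univ.prod (isCompact_sphere (0 : A') 1)).inter_left h1 using 1
    ext p
    simp
  convert h.image tT.continuous_ret using 1
  ext ξ
  constructor
  · intro hξ
    refine ⟨(ξ.1, tT.emb ξ.1 ξ.2), ⟨?_, hξ⟩, ?_⟩
    · exact congrArg (tT.emb ξ.1) (tT.ret_emb _ _)
    · exact congrArg (TotalSpace.mk ξ.1) (tT.ret_emb _ _)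
  · rintro ⟨p, ⟨h1, h2⟩, rfl⟩
    simpa only [Set.mem_ofPred_eq, h1] using h2

variable {F : Type*} [NormedAddCommGroup F] [InnerProductSpace ℂ F]
  {E : M → Type*} [∀ x, NormedAddCommGroup (E x)] [∀ x, InnerProductSpace ℂ (E x)]
  [TopologicalSpace (TotalSpace F E)] [FiberBundle F E] [VectorBundle ℂ F E]
  {m : ℝ} {σ : ∀ x : M, CotangentSpace I x → (E x →L[ℂ] E x)}

theorem IsEllipticSymbol.apply_zero (hσ : IsEllipticSymbol I F m σ) (hm : 0 < m) (x : M) :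
    σ x 0 = 0 := by
  have h := hσ.homogeneous x 0 2 two_pos
  rw [smul_zero] at h
  have h2 : (((2 : ℝ) ^ m : ℝ) : ℂ) - 1 ≠ 0 := by
    rw [sub_ne_zero]
    exact_mod_cast (Real.one_lt_rpow one_lt_two hm).ne'
  have h3 : ((((2 : ℝ) ^ m : ℝ) : ℂ) - 1) • σ x 0 = 0 := by
    rw [sub_smul, one_smul, ← h, sub_self]
  exact (smul_eq_zero.1 h3).resolve_left h2

variable {A : Type*} [NormedAddCommGroup A] [NormedSpace ℂ A] [FiniteDimensional ℂ A]
  (tE : TrivialEmbedding ℂ F E A)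

include tT in
/-- A symbol of positive order is continuous across the zero section: by homogeneity and
compactness of the cospheres it is bounded by a multiple of `‖ξ‖ ^ m`. -/
theorem IsEllipticSymbol.continuous [CompactSpace M] [FiniteDimensional ℝ A']
    (hσ : IsEllipticSymbol I F m σ) (hm : 0 < m) :
    Continuous fun ξ : CotangentBundle I M => (tE.emb ξ.1).comp ((σ ξ.1 ξ.2).comp (tE.ret ξ.1)) := by
  set f := fun ξ : CotangentBundle I M => (tE.emb ξ.1).comp ((σ ξ.1 ξ.2).comp (tE.ret ξ.1)) with hf
  have hN : Continuous fun ξ : CotangentBundle I M => ‖tT.emb ξ.1 ξ.2‖ := tT.continuous_emb.norm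
  have hN0 : ∀ ξ : CotangentBundle I M, ‖tT.emb ξ.1 ξ.2‖ = 0 ↔ ξ.2 = 0 := fun ξ => by
    rw [norm_eq_zero, map_eq_zero_iff _ (tT.emb_injective ξ.1)]
  have hopen : IsOpen {ξ : CotangentBundle I M | ξ.2 ≠ 0} := by
    convert isOpen_ne_fun hN continuous_const using 1
    ext ξ
    exact (hN0 ξ).symm.not
  have hcont : ContinuousOn f {ξ | ξ.2 ≠ 0} := by
    rw [continuousOn_clm_apply]
    intro c
    have h1 := ContinuousOn.clm_bundle_apply (F₁ := F) (F₂ := F) (E₁ := E) (E₂ := E)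
      (b := fun ξ : CotangentBundle I M => ξ.1) (v := fun ξ => tE.ret ξ.1 c) hσ.continuousOn
      (tE.continuous_ret_comp (FiberBundle.continuous_proj _ _) continuous_const).continuousOn
    exact tE.continuous_emb.comp_continuousOn h1
  have hS := isCompact_norm_emb_eq_one tT
  obtain ⟨C, hC⟩ := hS.exists_bound_of_continuousOn (f := f) (hcont.mono fun ξ hξ h0 => by
    rw [Set.mem_ofPred_eq, (hN0 ξ).2 h0] at hξ
    exact zero_ne_one hξ)
  have hbd : ∀ ξ, ‖f ξ‖ ≤ C * ‖tT.emb ξ.1 ξ.2‖ ^ m := by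
    rintro ⟨x, ξ⟩
    rcases eq_or_ne ξ 0 with rfl | hξ
    · simp [hf, hσ.apply_zero hm, Real.zero_rpow hm.ne']
    set N := ‖tT.emb x ξ‖ with hNdef
    have hNpos : 0 < N := (norm_nonneg _).lt_of_ne' (mt (hN0 ⟨x, ξ⟩).1 hξ)
    have h1 : f ⟨x, ξ⟩ = ((N ^ m : ℝ) : ℂ) • f ⟨x, N⁻¹ • ξ⟩ := by
      have h2 := hσ.homogeneous x (N⁻¹ • ξ) N hNpos
      rw [smul_smul, mul_inv_cancel₀ hNpos.ne', one_smul] at h2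
      simp only [hf]
      rw [h2, ContinuousLinearMap.smul_comp, ContinuousLinearMap.comp_smul]
    have h3 : ‖f ⟨x, N⁻¹ • ξ⟩‖ ≤ C := hC ⟨x, N⁻¹ • ξ⟩ (by
      simp only [Set.mem_ofPred_eq, map_smul, norm_smul, norm_inv, ← hNdef,
        Real.norm_of_nonneg hNpos.le, inv_mul_cancel₀ hNpos.ne'])
    rw [h1, norm_smul, Complex.norm_real, Real.norm_of_nonneg (by positivity), mul_comm]
    gcongr
  refine continuous_iff_continuousAt.2 fun ξ => ?_
  by_cases hξ : ξ.2 = 0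
  · have h0 : f ξ = 0 := by simp [hf, hξ, hσ.apply_zero hm]
    rw [ContinuousAt, h0]
    refine squeeze_zero_norm hbd ?_
    have h1 := ((hN.rpow_const fun _ => Or.inr hm.le).const_mul C).tendsto ξ
    rwa [(hN0 ξ).2 hξ, Real.zero_rpow hm.ne', mul_zero] at h1
  · exact hcont.continuousAt (hopen.mem_nhds hξ)

end CotangentContinuity

section CotangentProd

variable {B₁ : Type*} [NormedAddCommGroup B₁] [NormedSpace ℝ B₁] [FiniteDimensional ℝ B₁]
  {H₁ : Type*} [TopologicalSpace H₁]
  {I₁ : ModelWithCorners ℝ B₁ H₁} {M₁ : Type*} [TopologicalSpace M₁] [ChartedSpace H₁ M₁]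
  [IsManifold I₁ 1 M₁]
  {B₂ : Type*} [NormedAddCommGroup B₂] [NormedSpace ℝ B₂] [FiniteDimensional ℝ B₂]
  {H₂ : Type*} [TopologicalSpace H₂]
  {I₂ : ModelWithCorners ℝ B₂ H₂} {M₂ : Type*} [TopologicalSpace M₂] [ChartedSpace H₂ M₂]
  [IsManifold I₂ 1 M₂]

/-- To check that a map into a cotangent bundle is continuous it suffices to pair it with the local
frames of the tangent bundle. -/
theorem continuousAt_cotangentBundle {X : Type*} [TopologicalSpace X] {f : X → M₁}
    {η : ∀ x, CotangentSpace I₁ (f x)} {x₀ : X} (hf : ContinuousAt f x₀)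
    (h : ∀ v : B₁, ContinuousAt (fun x => η x
      ((FiberBundle.trivializationAt B₁ (TangentSpace I₁) (f x₀)).symmL ℝ (f x) v)) x₀) :
    ContinuousAt (fun x => (⟨f x, η x⟩ : CotangentBundle I₁ M₁)) x₀ := by
  refine (continuousAt_hom_bundle (RingHom.id ℝ) _).2 ⟨hf, ?_⟩
  rw [continuousAt_clm_apply]
  intro v
  simpa [ContinuousLinearMap.inCoordinates] using h v

theorem ContinuousAt.cotangent_apply {X : Type*} [TopologicalSpace X] {f : X → M₁}
    {η : ∀ x, CotangentSpace I₁ (f x)} {v : ∀ x, TangentSpace I₁ (f x)} {x₀ : X}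
    (hη : ContinuousAt (fun x => (⟨f x, η x⟩ : CotangentBundle I₁ M₁)) x₀)
    (hv : ContinuousAt (fun x => (⟨f x, v x⟩ : TangentBundle I₁ M₁)) x₀) :
    ContinuousAt (fun x => η x (v x)) x₀ :=
  ((FiberBundle.continuousAt_totalSpace _ _).1
    (ContinuousAt.clm_bundle_apply (F₁ := B₁) (F₂ := ℝ) (E₂ := Bundle.Trivial M₁ ℝ) hη hv)).2

theorem continuousAt_symmL_trivializationAt {X : Type*} [TopologicalSpace X] {f : X → M₁} {x₀ : X}
    (hf : ContinuousAt f x₀) (v : B₁) :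
    ContinuousAt (fun x => (⟨f x, (FiberBundle.trivializationAt B₁ (TangentSpace I₁) (f x₀)).symmL ℝ
      (f x) v⟩ : TangentBundle I₁ M₁)) x₀ := by
  set e := FiberBundle.trivializationAt B₁ (TangentSpace I₁) (f x₀) with he
  have hx₀ : f x₀ ∈ e.baseSet := FiberBundle.mem_baseSet_trivializationAt B₁ (TangentSpace I₁) _
  rw [FiberBundle.continuousAt_totalSpace]
  refine ⟨hf, (continuousAt_const (y := v)).congr ?_⟩
  filter_upwards [hf.eventually (e.open_baseSet.mem_nhds hx₀)] with x hx
  have h := e.continuousLinearMapAt_symmL (R := ℝ) hx v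
  rw [e.continuousLinearMapAt_apply ℝ, e.coe_linearMapAt_of_mem hx] at h
  exact h.symm

/-- The component along `T*M₁` of a covector of `M₁ × M₂` depends continuously on it: its pairing
with a local frame of `TM₁` is the pairing of the covector with that frame extended by zero. -/
theorem continuous_cotangentSpace_fst :
    Continuous fun ξ : CotangentBundle (I₁.prod I₂) (M₁ × M₂) =>
      (⟨ξ.1.1, ξ.2.fst⟩ : CotangentBundle I₁ M₁) := by
  have hproj : Continuous fun ξ : CotangentBundle (I₁.prod I₂) (M₁ × M₂) => ξ.1 :=
    FiberBundle.continuous_proj _ _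
  refine continuous_iff_continuousAt.2 fun ξ₀ =>
    continuousAt_cotangentBundle hproj.fst.continuousAt fun v => ?_
  have h1 := ((contMDiff_equivTangentBundleProd_symm (n := 0) (I := I₁) (M := M₁) (I' := I₂)
    (M' := M₂)).continuous.continuousAt).comp (x := ξ₀)
    ((continuousAt_symmL_trivializationAt (I₁ := I₁) hproj.fst.continuousAt v).prodMk
      (((Bundle.Trivialization.continuous_zeroSection ℝ (F := B₂) (E := TangentSpace I₂)).comp
        hproj.snd).continuousAt))
  exact ContinuousAt.cotangent_apply (I₁ := I₁.prod I₂)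
    (f := fun ξ : CotangentBundle (I₁.prod I₂) (M₁ × M₂) => ξ.1) (η := fun ξ => ξ.2)
    (v := fun ξ => ((FiberBundle.trivializationAt B₁ (TangentSpace I₁) ξ₀.1.1).symmL ℝ ξ.1.1 v,
      (0 : TangentSpace I₂ ξ.1.2))) continuousAt_id h1

theorem continuous_cotangentSpace_snd :
    Continuous fun ξ : CotangentBundle (I₁.prod I₂) (M₁ × M₂) =>
      (⟨ξ.1.2, ξ.2.snd⟩ : CotangentBundle I₂ M₂) := by
  have hproj : Continuous fun ξ : CotangentBundle (I₁.prod I₂) (M₁ × M₂) => ξ.1 :=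
    FiberBundle.continuous_proj _ _
  refine continuous_iff_continuousAt.2 fun ξ₀ =>
    continuousAt_cotangentBundle hproj.snd.continuousAt fun v => ?_
  have h1 := ((contMDiff_equivTangentBundleProd_symm (n := 0) (I := I₁) (M := M₁) (I' := I₂)
    (M' := M₂)).continuous.continuousAt).comp (x := ξ₀)
    (((Bundle.Trivialization.continuous_zeroSection ℝ (F := B₁) (E := TangentSpace I₁)).comp
        hproj.fst).continuousAt.prodMk
      (continuousAt_symmL_trivializationAt (I₁ := I₂) hproj.snd.continuousAt v))
  exact ContinuousAt.cotangent_apply (I₁ := I₁.prod I₂)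
    (f := fun ξ : CotangentBundle (I₁.prod I₂) (M₁ × M₂) => ξ.1) (η := fun ξ => ξ.2)
    (v := fun ξ => ((0 : TangentSpace I₁ ξ.1.1),
      (FiberBundle.trivializationAt B₂ (TangentSpace I₂) ξ₀.1.2).symmL ℝ ξ.1.2 v)) continuousAt_id h1

theorem CotangentSpace.ext_fst_snd {x : M₁ × M₂} {ξ : CotangentSpace (I₁.prod I₂) x}
    (h1 : ξ.fst = 0) (h2 : ξ.snd = 0) : ξ = 0 := by
  refine ContinuousLinearMap.ext fun v => ?_
  have h3 : ξ (v.1, 0) = 0 := DFunLike.congr_fun h1 v.1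
  have h4 : ξ (0, v.2) = 0 := DFunLike.congr_fun h2 v.2
  have h5 : ∀ w : B₁ × B₂, w = (w.1, 0) + (0, w.2) := fun w => by simp
  have h6 : ξ v = ξ (v.1, 0) + ξ (0, v.2) := (congrArg ξ (h5 v)).trans (map_add ξ _ _)
  rw [h6, h3, h4, add_zero]
  rfl

end CotangentProd

/-! ### Embeddings of products and external tensor products -/

namespace TrivialEmbedding

section Coordinates

variable {𝕜 : Type*} [RCLike 𝕜] {M : Type*} [TopologicalSpace M]
  {F : Type*} [NormedAddCommGroup F] [NormedSpace 𝕜 F]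
  {E : M → Type*} [∀ x, AddCommGroup (E x)] [∀ x, Module 𝕜 (E x)] [∀ x, TopologicalSpace (E x)]
  [TopologicalSpace (TotalSpace F E)] [FiberBundle F E] [VectorBundle 𝕜 F E]
  {A : Type*} [NormedAddCommGroup A] [NormedSpace 𝕜 A] (t : TrivialEmbedding 𝕜 F E A)
  (e : Trivialization F (TotalSpace.proj (F := F) (E := E))) [MemTrivializationAtlas e]

theorem continuousOn_emb_comp_symmL [FiniteDimensional 𝕜 F] :
    ContinuousOn (fun x => (t.emb x).comp (e.symmL 𝕜 x)) e.baseSet := by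
  rw [continuousOn_clm_apply]
  intro c
  have h : ContinuousOn (fun x => (⟨x, e.symm x c⟩ : TotalSpace F E)) e.baseSet :=
    e.continuousOn_symm.comp (f := fun x => (x, c)) (by fun_prop) fun x hx => ⟨hx, Set.mem_univ _⟩
  refine (t.continuous_emb.comp_continuousOn h).congr fun x hx => ?_
  simp only [ContinuousLinearMap.comp_apply, e.symmL_apply hx, Function.comp]

theorem continuousOn_continuousLinearMapAt_comp_ret [FiniteDimensional 𝕜 A] :
    ContinuousOn (fun x => (e.continuousLinearMapAt 𝕜 x).comp (t.ret x)) e.baseSet := by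
  rw [continuousOn_clm_apply]
  intro c
  have h : ContinuousOn (fun x => (e ⟨x, t.ret x c⟩).2) e.baseSet :=
    continuous_snd.comp_continuousOn (e.continuousOn.comp
      (t.continuous_ret_comp continuous_id continuous_const).continuousOn
      fun x hx => e.mem_source.2 hx)
  refine h.congr fun x hx => ?_
  rw [ContinuousLinearMap.comp_apply, e.continuousLinearMapAt_apply 𝕜, e.coe_linearMapAt_of_mem hx]

theorem continuous_emb_comp_ret [FiniteDimensional 𝕜 A] :
    Continuous fun x => (t.emb x).comp (t.ret x) := by
  rw [continuous_clm_apply]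
  exact fun c => t.continuous_emb.comp (t.continuous_ret_comp continuous_id continuous_const)

/-- The embedding of the direct sum `E ⊕ E`. -/
noncomputable def prodSelf : TrivialEmbedding 𝕜 (F × F) (E ×ᵇ E) (A × A) where
  emb x := (t.emb x).prodMap (t.emb x)
  ret x := (t.ret x).prodMap (t.ret x)
  ret_emb x v := Prod.ext (t.ret_emb x v.1) (t.ret_emb x v.2)
  continuous_emb := by
    have h := (FiberBundle.Prod.isInducing_diag F E F E).continuous
    exact (t.continuous_emb.comp (continuous_fst.comp h)).prodMk
      (t.continuous_emb.comp (continuous_snd.comp h))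
  continuous_ret := by
    rw [(FiberBundle.Prod.isInducing_diag F E F E).continuous_iff]
    exact (t.continuous_ret_comp continuous_fst continuous_snd.fst).prodMk
      (t.continuous_ret_comp continuous_fst continuous_snd.snd)

end Coordinates

theorem prodSelf_emb_blockOperator {M : Type*} [TopologicalSpace M]
    {F : Type*} [NormedAddCommGroup F] [NormedSpace ℂ F]
    {E : M → Type*} [∀ x, NormedAddCommGroup (E x)] [∀ x, NormedSpace ℂ (E x)]
    [TopologicalSpace (TotalSpace F E)] [FiberBundle F E] [VectorBundle ℂ F E] {A : Type*} [NormedAddCommGroup A] [NormedSpace ℂ A]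
    (t : TrivialEmbedding ℂ F E A) (x : M) (a b c d : E x →L[ℂ] E x) (p : A × A) :
    t.prodSelf.emb x (blockOperator a b c d (t.prodSelf.ret x p)) =
      (t.emb x (a (t.ret x p.1)) + t.emb x (b (t.ret x p.2)),
        t.emb x (c (t.ret x p.1)) + t.emb x (d (t.ret x p.2))) :=
  Prod.ext (map_add (t.emb x) _ _) (map_add (t.emb x) _ _)

section Tensor

variable {M₁ M₂ : Type*} [TopologicalSpace M₁] [TopologicalSpace M₂]
  {F₁ : Type*} [NormedAddCommGroup F₁] [InnerProductSpace ℂ F₁] [FiniteDimensional ℂ F₁]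
  {E₁ : M₁ → Type*} [∀ x, NormedAddCommGroup (E₁ x)] [∀ x, InnerProductSpace ℂ (E₁ x)]
  [TopologicalSpace (TotalSpace F₁ E₁)] [FiberBundle F₁ E₁] [VectorBundle ℂ F₁ E₁]
  {F₂ : Type*} [NormedAddCommGroup F₂] [InnerProductSpace ℂ F₂] [FiniteDimensional ℂ F₂]
  {E₂ : M₂ → Type*} [∀ x, NormedAddCommGroup (E₂ x)] [∀ x, InnerProductSpace ℂ (E₂ x)]
  [TopologicalSpace (TotalSpace F₂ E₂)] [FiberBundle F₂ E₂] [VectorBundle ℂ F₂ E₂]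
  {A₁ : Type*} [NormedAddCommGroup A₁] [InnerProductSpace ℂ A₁] [FiniteDimensional ℂ A₁]
  {A₂ : Type*} [NormedAddCommGroup A₂] [InnerProductSpace ℂ A₂] [FiniteDimensional ℂ A₂]

theorem _root_.ExtTensor.trivializationAt_apply (x₀ : M₁ × M₂)
    (v : TotalSpace (F₁ ⊗[ℂ] F₂) (ExtTensor E₁ E₂)) :
    FiberBundle.trivializationAt (F₁ ⊗[ℂ] F₂) (ExtTensor E₁ E₂) x₀ v =
      (v.1, TensorProduct.mapL
        ((FiberBundle.trivializationAt F₁ E₁ x₀.1).continuousLinearMapAt ℂ v.1.1)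
        ((FiberBundle.trivializationAt F₂ E₂ x₀.2).continuousLinearMapAt ℂ v.1.2) v.2) :=
  rfl

/-- The tensor product of two embeddings embeds the external tensor product. -/
noncomputable def extTensor (t₁ : TrivialEmbedding ℂ F₁ E₁ A₁) (t₂ : TrivialEmbedding ℂ F₂ E₂ A₂) :
    TrivialEmbedding ℂ (F₁ ⊗[ℂ] F₂) (ExtTensor E₁ E₂) (A₁ ⊗[ℂ] A₂) where
  emb x := TensorProduct.mapL (t₁.emb x.1) (t₂.emb x.2)
  ret x := TensorProduct.mapL (t₁.ret x.1) (t₂.ret x.2)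
  ret_emb x v := by
    have h₁ : (t₁.ret x.1).comp (t₁.emb x.1) = .id ℂ _ := by ext v; exact t₁.ret_emb _ v
    have h₂ : (t₂.ret x.2).comp (t₂.emb x.2) = .id ℂ _ := by ext v; exact t₂.ret_emb _ v
    rw [← ContinuousLinearMap.comp_apply, ← TensorProduct.mapL_comp, h₁, h₂,
      TensorProduct.mapL_id_id]
    rfl
  continuous_emb := by
    refine continuous_iff_continuousAt.2 fun v₀ => ?_
    set e₁ := FiberBundle.trivializationAt F₁ E₁ v₀.1.1 with he₁
    set e₂ := FiberBundle.trivializationAt F₂ E₂ v₀.1.2 with he₂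
    have hmem : e₁.baseSet ×ˢ e₂.baseSet ∈ 𝓝 v₀.1 :=
      (e₁.open_baseSet.prod e₂.open_baseSet).mem_nhds
        ⟨FiberBundle.mem_baseSet_trivializationAt F₁ E₁ _,
          FiberBundle.mem_baseSet_trivializationAt F₂ E₂ _⟩
    have hproj := FiberBundle.continuous_proj (F₁ ⊗[ℂ] F₂) (ExtTensor E₁ E₂)
    have h1 : ContinuousOn (fun x : M₁ × M₂ => TensorProduct.mapL
        ((t₁.emb x.1).comp (e₁.symmL ℂ x.1)) ((t₂.emb x.2).comp (e₂.symmL ℂ x.2)))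
        (e₁.baseSet ×ˢ e₂.baseSet) :=
      ((t₁.continuousOn_emb_comp_symmL e₁).comp continuousOn_fst fun _ h => h.1).mapL
        ((t₂.continuousOn_emb_comp_symmL e₂).comp continuousOn_snd fun _ h => h.2)
    have h2 := ((FiberBundle.continuousAt_totalSpace (F₁ ⊗[ℂ] F₂)
      (fun v : TotalSpace (F₁ ⊗[ℂ] F₂) (ExtTensor E₁ E₂) => v) (x₀ := v₀)).1 continuousAt_id).2
    refine (((h1.continuousAt hmem).comp hproj.continuousAt).clm_apply h2).congr ?_
    filter_upwards [hproj.continuousAt.eventually hmem] with v hv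
    have a : (e₁.symmL ℂ v.1.1).comp (e₁.continuousLinearMapAt ℂ v.1.1) = .id ℂ _ := by
      ext w; exact e₁.symmL_continuousLinearMapAt hv.1 w
    have b : (e₂.symmL ℂ v.1.2).comp (e₂.continuousLinearMapAt ℂ v.1.2) = .id ℂ _ := by
      ext w; exact e₂.symmL_continuousLinearMapAt hv.2 w
    rw [ExtTensor.trivializationAt_apply]
    simp only [Function.comp]
    rw [← ContinuousLinearMap.comp_apply, ← TensorProduct.mapL_comp, ContinuousLinearMap.comp_assoc,
      ContinuousLinearMap.comp_assoc, a, b]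
    rfl
  continuous_ret := by
    refine continuous_iff_continuousAt.2 fun p₀ => ?_
    rw [FiberBundle.continuousAt_totalSpace]
    refine ⟨continuousAt_fst, ?_⟩
    set e₁ := FiberBundle.trivializationAt F₁ E₁ p₀.1.1 with he₁
    set e₂ := FiberBundle.trivializationAt F₂ E₂ p₀.1.2 with he₂
    have hmem : e₁.baseSet ×ˢ e₂.baseSet ∈ 𝓝 p₀.1 :=
      (e₁.open_baseSet.prod e₂.open_baseSet).mem_nhds
        ⟨FiberBundle.mem_baseSet_trivializationAt F₁ E₁ _,
          FiberBundle.mem_baseSet_trivializationAt F₂ E₂ _⟩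
    have h1 : ContinuousOn (fun x : M₁ × M₂ => TensorProduct.mapL
        ((e₁.continuousLinearMapAt ℂ x.1).comp (t₁.ret x.1))
        ((e₂.continuousLinearMapAt ℂ x.2).comp (t₂.ret x.2)))
        (e₁.baseSet ×ˢ e₂.baseSet) :=
      ((t₁.continuousOn_continuousLinearMapAt_comp_ret e₁).comp continuousOn_fst
        fun _ h => h.1).mapL
        ((t₂.continuousOn_continuousLinearMapAt_comp_ret e₂).comp continuousOn_snd fun _ h => h.2)
    refine (((h1.continuousAt hmem).comp continuousAt_fst).clm_apply continuousAt_snd).congr ?_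
    refine Filter.Eventually.of_forall fun p => ?_
    refine Eq.trans ?_ (congrArg Prod.snd (ExtTensor.trivializationAt_apply (F₁ := F₁) (E₁ := E₁)
      (F₂ := F₂) (E₂ := E₂) p₀.1 ⟨p.1, _⟩)).symm
    simp only [Function.comp]
    rw [TensorProduct.mapL_comp]
    rfl

end Tensor

end TrivialEmbedding

/-! ### Families of subspaces intertwined with the antipode by a swap -/

section OddEmbedding

variable (Y : Type*) [NormedAddCommGroup Y] [NormedSpace ℂ Y] {k : ℕ}

/-- The embedding `(u, v) ↦ (u + v, f ⊗ (u - v))` of `Y × Y`, for a real vector `f ≠ 0`. It is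
invariant under swapping `u` and `v` and changing the sign of `f`. -/
def oddEmbedding (f : EuclideanSpace ℝ (Fin k)) : Y × Y →ₗ[ℂ] Y × (Fin k → Y) :=
  (LinearMap.fst ℂ Y Y + LinearMap.snd ℂ Y Y).prod
    (LinearMap.pi fun i => (f i : ℂ) • (LinearMap.fst ℂ Y Y - LinearMap.snd ℂ Y Y))

/-- A left inverse of `oddEmbedding` (for `f ≠ 0`). -/
noncomputable def oddRetraction (f : EuclideanSpace ℝ (Fin k)) : Y × (Fin k → Y) →ₗ[ℂ] Y × Y :=
  let d : Y × (Fin k → Y) →ₗ[ℂ] Y := (((‖f‖ ^ 2)⁻¹ : ℝ) : ℂ) •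
    ∑ i, (f i : ℂ) • (LinearMap.proj (R := ℂ) (φ := fun _ : Fin k => Y) i ∘ₗ
      LinearMap.snd ℂ Y (Fin k → Y))
  ((1 / 2 : ℂ) • (LinearMap.fst ℂ Y _ + d)).prod ((1 / 2 : ℂ) • (LinearMap.fst ℂ Y _ - d))

variable {Y}

theorem oddEmbedding_apply (f : EuclideanSpace ℝ (Fin k)) (w : Y × Y) :
    oddEmbedding Y f w = (w.1 + w.2, fun i => (f i : ℂ) • (w.1 - w.2)) :=
  rfl

theorem oddRetraction_apply (f : EuclideanSpace ℝ (Fin k)) (z : Y × (Fin k → Y)) :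
    oddRetraction Y f z =
      ((1 / 2 : ℂ) • (z.1 + (((‖f‖ ^ 2)⁻¹ : ℝ) : ℂ) • ∑ i, (f i : ℂ) • z.2 i),
        (1 / 2 : ℂ) • (z.1 - (((‖f‖ ^ 2)⁻¹ : ℝ) : ℂ) • ∑ i, (f i : ℂ) • z.2 i)) := by
  simp [oddRetraction]

theorem oddEmbedding_neg_swap (f : EuclideanSpace ℝ (Fin k)) (w : Y × Y) :
    oddEmbedding Y (-f) w.swap = oddEmbedding Y f w := by
  simp only [oddEmbedding_apply, Prod.fst_swap, Prod.snd_swap, PiLp.neg_apply, Complex.ofReal_neg,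
    neg_smul, ← smul_neg, neg_sub, add_comm w.2]

theorem oddRetraction_oddEmbedding {f : EuclideanSpace ℝ (Fin k)} (hf : f ≠ 0) (w : Y × Y) :
    oddRetraction Y f (oddEmbedding Y f w) = w := by
  have h1 : (((‖f‖ ^ 2)⁻¹ : ℝ) : ℂ) • ∑ i, (f i : ℂ) • (f i : ℂ) • (w.1 - w.2) = w.1 - w.2 := by
    have h2 : ∑ i, (f i : ℂ) * (f i : ℂ) = ((‖f‖ ^ 2 : ℝ) : ℂ) := by
      rw [EuclideanSpace.real_norm_sq_eq]
      push_cast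
      exact Finset.sum_congr rfl fun i _ => (sq _).symm
    simp_rw [smul_smul]
    rw [← Finset.sum_smul, h2, smul_smul, ← Complex.ofReal_mul,
      inv_mul_cancel₀ (pow_ne_zero 2 (norm_ne_zero_iff.2 hf)), Complex.ofReal_one, one_smul]
  rw [oddRetraction_apply, oddEmbedding_apply]
  simp only
  rw [h1]
  refine Prod.ext ?_ ?_
  · change (1 / 2 : ℂ) • (w.1 + w.2 + (w.1 - w.2)) = w.1
    module
  · change (1 / 2 : ℂ) • (w.1 + w.2 - (w.1 - w.2)) = w.2
    module

theorem Continuous.oddEmbedding {X : Type*} [TopologicalSpace X] {f : X → EuclideanSpace ℝ (Fin k)}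
    {w : X → Y × Y} (hf : Continuous f) (hw : Continuous w) :
    Continuous fun x => oddEmbedding Y (f x) (w x) := by
  simp only [oddEmbedding_apply]
  have hi : ∀ i, Continuous fun x => ((f x i : ℝ) : ℂ) := fun i =>
    Complex.continuous_ofReal.comp ((EuclideanSpace.proj i).continuous.comp hf)
  exact (hw.fst.add hw.snd).prodMk (continuous_pi fun i => (hi i).smul (hw.fst.sub hw.snd))

theorem Continuous.oddRetraction {X : Type*} [TopologicalSpace X]
    {f : X → EuclideanSpace ℝ (Fin k)} {z : X → Y × (Fin k → Y)} (hf : Continuous f)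
    (hf0 : ∀ x, f x ≠ 0) (hz : Continuous z) :
    Continuous fun x => oddRetraction Y (f x) (z x) := by
  simp only [oddRetraction_apply]
  have hi : ∀ i, Continuous fun x => ((f x i : ℝ) : ℂ) := fun i =>
    Complex.continuous_ofReal.comp ((EuclideanSpace.proj i).continuous.comp hf)
  have hd : Continuous fun x => (((‖f x‖ ^ 2)⁻¹ : ℝ) : ℂ) • ∑ i, (f x i : ℂ) • (z x).2 i :=
    (Complex.continuous_ofReal.comp ((hf.norm.pow 2).inv₀ fun x =>
      pow_ne_zero 2 (norm_ne_zero_iff.2 (hf0 x)))).smul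
      (continuous_finsetSum _ fun i _ => (hi i).smul ((continuous_apply i).comp hz.snd))
  exact ((hz.fst.add hd).const_smul _).prodMk ((hz.fst.sub hd).const_smul _)

end OddEmbedding

section EvenBundle

variable {B : Type*} [NormedAddCommGroup B] [NormedSpace ℝ B] {H : Type*} [TopologicalSpace H]
  {I : ModelWithCorners ℝ B H} {M : Type*} [TopologicalSpace M] [ChartedSpace H M]
  [IsManifold I 1 M] {k : ℕ}
  (tT : TrivialEmbedding ℝ (B →L[ℝ] ℝ) (fun x : M => CotangentSpace I x) (EuclideanSpace ℝ (Fin k)))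
  {g : CotangentMetric I M}
  {F : Type*} [NormedAddCommGroup F] [NormedSpace ℂ F]
  {V : M → Type*} [∀ x, NormedAddCommGroup (V x)] [∀ x, NormedSpace ℂ (V x)]
  [TopologicalSpace (TotalSpace F V)] [FiberBundle F V] [VectorBundle ℂ F V]
  {Y : Type} [NormedAddCommGroup Y] [NormedSpace ℂ Y] [FiniteDimensional ℂ Y]
  (s : TrivialEmbedding ℂ F V Y)

theorem TrivialEmbedding.isInducing_pullback {X : Type*} [TopologicalSpace X] {A : Type*}
    [NormedAddCommGroup A] [NormedSpace ℂ A] (f : C(X, M)) (t : TrivialEmbedding ℂ F V A) :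
    IsInducing fun v : TotalSpace F (f *ᵖ V) => (v.1, t.emb (f v.1) v.2) := by
  have h1 := inducing_pullbackTotalSpaceEmbedding F V f
  have h2 : IsInducing fun v : TotalSpace F (f *ᵖ V) => (v.1, (f v.1, t.emb (f v.1) v.2)) :=
    (IsInducing.id.prodMap t.isInducing).comp h1
  exact IsInducing.of_comp (g := fun p : X × A => (p.1, (f p.1, p.2)))
    (continuous_fst.prodMk continuous_snd.snd |>.comp h2.continuous) (by fun_prop) h2

theorem Submodule.apply_equivMapOfInjective_symm {W A C : Type*} [AddCommGroup W] [Module ℂ W]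
    [AddCommGroup A] [Module ℂ A] [AddCommGroup C] [Module ℂ C] (j : W →ₗ[ℂ] A) (Θ : A →ₗ[ℂ] C)
    (Ω : C →ₗ[ℂ] A) (h : ∀ a, Ω (Θ a) = a) (hinj : Function.Injective (Θ ∘ₗ j))
    (L : Submodule ℂ W) (c : L.map (Θ ∘ₗ j)) :
    j ((L.equivMapOfInjective (Θ ∘ₗ j) hinj).symm c) = Ω c := by
  obtain ⟨v, rfl⟩ := (L.equivMapOfInjective (Θ ∘ₗ j) hinj).surjective c
  rw [LinearEquiv.symm_apply_apply, Submodule.coe_equivMapOfInjective_apply, LinearMap.comp_apply, h]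

variable (Y) in
include tT in
/-- Embeddings of `Y × Y` in a fixed space, parametrized by `S*M`, which are carried to each other
by the antipode and the swap of the factors. -/
theorem exists_swap_invariant_embedding (g : CotangentMetric I M) :
    ∃ (N : ℕ) (Θ : CosphereBundle g → Y × Y →ₗ[ℂ] EuclideanSpace ℂ (Fin N))
      (Ω : CosphereBundle g → EuclideanSpace ℂ (Fin N) →ₗ[ℂ] Y × Y),
      (∀ ξ w, Ω ξ (Θ ξ w) = w) ∧
      (Continuous fun p : CosphereBundle g × (Y × Y) => Θ p.1 p.2) ∧
      (Continuous fun p : CosphereBundle g × EuclideanSpace ℂ (Fin N) => Ω p.1 p.2) ∧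
      ∀ ξ w, Θ ξ.antipode w.swap = Θ ξ w := by
  let f : CosphereBundle g → EuclideanSpace ℝ (Fin k) := fun ξ => tT.emb ξ.1.1 ξ.1.2
  have hf : Continuous f := tT.continuous_emb.comp continuous_subtype_val
  have hf0 : ∀ ξ, f ξ ≠ 0 := fun ξ h0 =>
    ξ.snd_ne_zero (tT.emb_injective _ (by rw [map_zero]; exact h0))
  have hfneg : ∀ ξ : CosphereBundle g, f ξ.antipode = -f ξ := fun ξ => map_neg (tT.emb ξ.1.1) ξ.1.2
  let e : (Y × (Fin k → Y)) ≃L[ℂ] EuclideanSpace ℂ (Fin (Module.finrank ℂ (Y × (Fin k → Y)))) :=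
    ContinuousLinearEquiv.ofFinrankEq finrank_euclideanSpace_fin.symm
  refine ⟨_, fun ξ => e.toLinearMap ∘ₗ oddEmbedding Y (f ξ),
    fun ξ => oddRetraction Y (f ξ) ∘ₗ e.symm.toLinearMap, fun ξ w => ?_,
    e.continuous.comp ((hf.comp continuous_fst).oddEmbedding continuous_snd),
    (hf.comp continuous_fst).oddRetraction (fun p => hf0 p.1) (e.symm.continuous.comp continuous_snd),
    fun ξ w => ?_⟩
  · exact (congrArg _ (e.symm_apply_apply _)).trans (oddRetraction_oddEmbedding (hf0 ξ) w)
  · change e (oddEmbedding Y (f ξ.antipode) w.swap) = e (oddEmbedding Y (f ξ) w)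
    rw [hfneg, oddEmbedding_neg_swap]

include tT in
/-- If the antipode carries a closed family `L` of subspaces of `V ⊕ V` over `S*M` to the swapped
family, then `L` is isomorphic to an even family and comes from a bundle over `P*M`. -/
theorem exists_even_and_descent_of_swap
    (L : ∀ ξ : CosphereBundle g, Submodule ℂ ((CosphereBundle.proj g *ᵖ (V ×ᵇ V)) ξ))
    (hcl : IsClosed {p : CosphereBundle g × (Y × Y) |
      ∃ w ∈ L p.1, s.prodSelf.emb (CosphereBundle.proj g p.1) w = p.2})
    {r : ℕ} (hr : ∀ ξ, Module.finrank ℂ (L ξ) = r)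
    (hswap : ∀ ξ : CosphereBundle g, ∀ w : V ξ.1.1 × V ξ.1.1, w ∈ L ξ → w.swap ∈ L ξ.antipode) :
    (∃ L' : ComplexVectorBundle (ProjCotangentBundle g),
      FamiliesIsomorphic
        L'.Model (CosphereBundle.toProj g *ᵖ L'.Fiber) (F × F) (SubspaceFamily L)) ∧
    (∃ (G : ComplexVectorBundle M)
      (K : ∀ ξ : CosphereBundle g, Submodule ℂ ((CosphereBundle.proj g *ᵖ G.Fiber) ξ)),
      IsEvenFamily (W := G.Fiber) g K ∧
      FamiliesIsomorphic
        G.Model (SubspaceFamily (V := CosphereBundle.proj g *ᵖ G.Fiber) K)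
        (F × F) (SubspaceFamily L)) := by
  obtain ⟨N, Θ, Ω, hΩΘ, hΘ, hΩ, hΘswap⟩ := exists_swap_invariant_embedding tT Y g
  -- `s.prodSelf.emb`, with `V ⊕ V` written as a product of fibres
  obtain ⟨j, hjs⟩ : ∃ j : ∀ ξ : CosphereBundle g, V ξ.1.1 × V ξ.1.1 →ₗ[ℂ] Y × Y,
      ∀ ξ w, j ξ w = s.prodSelf.emb ξ.1.1 w := ⟨fun ξ => (s.prodSelf.emb ξ.1.1).toLinearMap,
        fun _ _ => rfl⟩
  have hinj : ∀ ξ, Function.Injective (Θ ξ ∘ₗ j ξ) := fun ξ =>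
    (Function.LeftInverse.injective (hΩΘ ξ)).comp fun v w h =>
      s.prodSelf.emb_injective ξ.1.1 (by rw [← hjs, h, hjs])
  let L₀ : ∀ ξ : CosphereBundle g, Submodule ℂ (V ξ.1.1 × V ξ.1.1) := L
  -- the image of `L`, as a family of subspaces of a fixed space
  let K : CosphereBundle g → Submodule ℂ (EuclideanSpace ℂ (Fin N)) := fun ξ =>
    (L₀ ξ).map (Θ ξ ∘ₗ j ξ)
  have hKle : ∀ ξ : CosphereBundle g, K ξ ≤ K ξ.antipode := by
    rintro ξ _ ⟨w, hw, rfl⟩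
    refine ⟨_, hswap ξ w hw, ?_⟩
    have h1 : j ξ.antipode w.swap = (j ξ w).swap :=
      (hjs ξ.antipode w.swap).trans (congrArg Prod.swap (hjs ξ w).symm)
    exact (congrArg (Θ ξ.antipode) h1).trans (hΘswap ξ _)
  have hKeven : ∀ ξ : CosphereBundle g, K ξ.antipode = K ξ := fun ξ =>
    le_antisymm ((hKle ξ.antipode).trans_eq (by rw [CosphereBundle.antipode_antipode])) (hKle ξ)
  have hKcl : IsClosed {p : CosphereBundle g × EuclideanSpace ℂ (Fin N) | p.2 ∈ K p.1} := by
    have h1 := (isClosed_eq (hΘ.comp (continuous_fst.prodMk hΩ)) continuous_snd).inter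
      (hcl.preimage (continuous_fst.prodMk hΩ))
    convert h1 using 1
    ext ⟨ξ, c⟩
    constructor
    · rintro ⟨w, hw, hwc⟩
      have h2 : Ω ξ c = j ξ w := (congrArg (Ω ξ) hwc.symm).trans (hΩΘ ξ _)
      exact ⟨(congrArg (Θ ξ) h2).trans hwc, w, hw, (hjs ξ w).symm.trans h2.symm⟩
    · rintro ⟨hc, w, hw, hwc⟩
      exact ⟨w, hw, (congrArg (Θ ξ) ((hjs ξ w).trans hwc)).trans hc⟩
  let Φ : ∀ ξ, K ξ ≃ₗ[ℂ] L₀ ξ := fun ξ =>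
    ((L₀ ξ).equivMapOfInjective (Θ ξ ∘ₗ j ξ) (hinj ξ)).symm
  have hΦsymm : ∀ ξ (v : L₀ ξ), ((Φ ξ).symm v : EuclideanSpace ℂ (Fin N)) = Θ ξ (j ξ v) :=
    fun ξ v => rfl
  have hΦ : ∀ ξ (c : K ξ), j ξ (Φ ξ c) = Ω ξ c := fun ξ c =>
    Submodule.apply_equivMapOfInjective_symm (j ξ) (Θ ξ) (Ω ξ) (hΩΘ ξ) (hinj ξ) (L₀ ξ) c
  have hLind : IsInducing fun v : TotalSpace (F × F) (SubspaceFamily L) =>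
      (v.1, j v.1 (SubspaceFamily.incl L v.1 v.2)) := by
    have h := (s.prodSelf.isInducing_pullback (CosphereBundle.proj g)).comp
      (f := fun v : TotalSpace (F × F) (SubspaceFamily L) =>
        (⟨v.1, SubspaceFamily.incl L v.1 v.2⟩ : TotalSpace _ _)) ⟨rfl⟩
    convert h using 1
    funext v
    exact congrArg (Prod.mk v.1) (hjs _ _)
  constructor
  · -- `K` is constant on the fibres of `S*M → P*M`, hence descends
    let K' : ProjCotangentBundle g → Submodule ℂ (EuclideanSpace ℂ (Fin N)) :=
      Quotient.lift K (by
        rintro ξ η (rfl | rfl)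
        · rfl
        · exact (hKeven ξ).symm)
    have hK'cl : IsClosed {p : ProjCotangentBundle g × EuclideanSpace ℂ (Fin N) | p.2 ∈ K' p.1} := by
      rw [← ((CosphereBundle.isOpenQuotientMap_toProj tT g).prodMap
        (IsOpenQuotientMap.id (X := EuclideanSpace ℂ (Fin N)))).isQuotientMap.isClosed_preimage]
      exact hKcl
    have hK'r : ∀ q, Module.finrank ℂ (K' q) = r := by
      intro q
      obtain ⟨ξ, rfl⟩ := Quotient.exists_rep q
      rw [← hr ξ]
      exact (Φ ξ).finrank_eq
    obtain ⟨L', e, he⟩ := ComplexVectorBundle.exists_of_isClosed hK'cl hK'r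
    let Φ' : ∀ ξ, L'.Fiber (CosphereBundle.toProj g ξ) ≃ₗ[ℂ] L₀ ξ := fun ξ =>
      (e (CosphereBundle.toProj g ξ)).trans (Φ ξ)
    refine ⟨L', FamiliesIsomorphic.of_isInducing (V' := SubspaceFamily L)
      (A := EuclideanSpace ℂ (Fin N)) (A' := Y × Y)
      (fun ξ v => (e (CosphereBundle.toProj g ξ) v : EuclideanSpace ℂ (Fin N)))
      (fun ξ v => j ξ (SubspaceFamily.incl L ξ v)) ?_ hLind (fun ξ => Ω ξ) hΩ (fun ξ => Θ ξ) hΘ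
      Φ' (fun ξ v => hΦ ξ _) fun ξ v => ?_⟩
    · have h2 : IsInducing fun v : TotalSpace L'.Model (CosphereBundle.toProj g *ᵖ L'.Fiber) =>
          (v.1, (CosphereBundle.toProj g v.1, (e _ v.2 : EuclideanSpace ℂ (Fin N)))) :=
        (IsInducing.id.prodMap he).comp
          (inducing_pullbackTotalSpaceEmbedding L'.Model L'.Fiber (CosphereBundle.toProj g))
      exact IsInducing.of_comp
        (g := fun p : CosphereBundle g × EuclideanSpace ℂ (Fin N) =>
          (p.1, (CosphereBundle.toProj g p.1, p.2)))
        ((continuous_fst.prodMk continuous_snd.snd).comp h2.continuous) (by fun_prop) h2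
    · exact (congrArg Subtype.val ((e _).apply_symm_apply _)).trans (hΦsymm ξ v)
  · -- `K` is an even family in the trivial bundle over `M`
    obtain ⟨G, e, he⟩ := ComplexVectorBundle.exists_trivial M N
    let KG : ∀ ξ : CosphereBundle g, Submodule ℂ (G.Fiber ξ.1.1) := fun ξ =>
      (K ξ).map (e ξ.1.1).symm.toLinearMap
    let KG' : ∀ ξ : CosphereBundle g, Submodule ℂ ((CosphereBundle.proj g *ᵖ G.Fiber) ξ) := KG
    let eK : ∀ ξ, K ξ ≃ₗ[ℂ] KG ξ := fun ξ => (e ξ.1.1).symm.submoduleMap (K ξ)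
    let Φ' : ∀ ξ, KG ξ ≃ₗ[ℂ] L₀ ξ := fun ξ => (eK ξ).symm.trans (Φ ξ)
    have heK : ∀ ξ (v : K ξ), e ξ.1.1 (eK ξ v) = v := fun ξ v => (e ξ.1.1).apply_symm_apply _
    refine ⟨G, KG', fun ξ => congrArg (Submodule.map (e ξ.1.1).symm.toLinearMap) (hKeven ξ),
      FamiliesIsomorphic.of_isInducing
      (V := SubspaceFamily (V := CosphereBundle.proj g *ᵖ G.Fiber) KG') (V' := SubspaceFamily L)
      (A := EuclideanSpace ℂ (Fin N)) (A' := Y × Y)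
      (fun ξ v => e ξ.1.1 (SubspaceFamily.incl KG' ξ v))
      (fun ξ v => j ξ (SubspaceFamily.incl L ξ v)) ?_ hLind (fun ξ => Ω ξ) hΩ (fun ξ => Θ ξ) hΘ
      Φ' (fun ξ v => ?_) fun ξ v => (heK ξ _).trans (hΦsymm ξ v)⟩
    · have h2 : IsInducing fun v : TotalSpace G.Model (CosphereBundle.proj g *ᵖ G.Fiber) =>
          (v.1, (CosphereBundle.proj g v.1, e _ v.2)) :=
        (IsInducing.id.prodMap he).comp
          (inducing_pullbackTotalSpaceEmbedding G.Model G.Fiber (CosphereBundle.proj g))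
      have h3 := IsInducing.of_comp
        (g := fun p : CosphereBundle g × EuclideanSpace ℂ (Fin N) =>
          (p.1, (CosphereBundle.proj g p.1, p.2)))
        ((continuous_fst.prodMk continuous_snd.snd).comp h2.continuous) (by fun_prop) h2
      exact h3.comp (f := fun v : TotalSpace G.Model (SubspaceFamily KG') =>
        (⟨v.1, SubspaceFamily.incl KG' v.1 v.2⟩ : TotalSpace _ _)) ⟨rfl⟩
    · exact hΦ ξ _

include tT in
/-- A symbol acting in `V ⊕ V` which the swap of the summands intertwines with its antipode has
even nonnegative spectral bundle, up to isomorphism, and this bundle comes from `P*M`. -/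
theorem nonnegSpectralBundle_even_and_descent_of_swap
    (σ : ∀ x : M, CotangentSpace I x → ((V ×ᵇ V) x →L[ℂ] (V ×ᵇ V) x))
    (hσ : Continuous fun p : CotangentBundle I M × (Y × Y) =>
      s.prodSelf.emb p.1.1 (σ p.1.1 p.1.2 (s.prodSelf.ret p.1.1 p.2))) {k r : ℕ}
    (hdiag : ∀ x ξ, ξ ≠ 0 → ∃ (b : Module.Basis (Fin k) ℂ ((V ×ᵇ V) x)) (c : Fin k → ℝ),
      ∀ i, σ x ξ (b i) = (c i : ℂ) • b i)
    (hr : ∀ x ξ, ξ ≠ 0 → Module.finrank ℂ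
      (nonnegSpectralSubspace (σ x ξ : (V ×ᵇ V) x →ₗ[ℂ] (V ×ᵇ V) x)) = r)
    (hswap : ∀ x ξ (w : V x × V x), Prod.swap (σ x ξ w) = σ x (-ξ) (Prod.swap w)) :
    (∃ L' : ComplexVectorBundle (ProjCotangentBundle g),
      FamiliesIsomorphic L'.Model (CosphereBundle.toProj g *ᵖ L'.Fiber)
        (F × F) (SubspaceFamily (nonnegSpectralBundle g σ))) ∧
    (∃ (G : ComplexVectorBundle M)
      (K : ∀ ξ : CosphereBundle g, Submodule ℂ ((CosphereBundle.proj g *ᵖ G.Fiber) ξ)),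
      IsEvenFamily (W := G.Fiber) g K ∧
      FamiliesIsomorphic
        G.Model (SubspaceFamily (V := CosphereBundle.proj g *ᵖ G.Fiber) K)
        (F × F) (SubspaceFamily (nonnegSpectralBundle g σ))) := by
  refine exists_even_and_descent_of_swap tT s (nonnegSpectralBundle g σ) ?_
    (fun ξ => hr _ _ ξ.snd_ne_zero) fun ξ w hw => ?_
  · exact isClosed_map_nonnegSpectralSubspace
      (fun ξ : CosphereBundle g => (σ ξ.1.1 ξ.1.2).toLinearMap)
      (fun ξ => (s.prodSelf.emb ξ.1.1).toLinearMap) (fun ξ => (s.prodSelf.ret ξ.1.1).toLinearMap)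
      (fun ξ => s.prodSelf.ret_emb ξ.1.1)
      (hσ.comp (continuous_subtype_val.prodMap continuous_id))
      (s.prodSelf.continuous_emb.comp (s.prodSelf.continuous_ret_comp
        ((CosphereBundle.proj g).continuous.comp continuous_fst) continuous_snd))
      fun ξ => hdiag _ _ ξ.snd_ne_zero
  · exact map_nonnegSpectralSubspace_le (T := (σ ξ.1.1 ξ.1.2).toLinearMap)
      (T' := (σ ξ.1.1 (-ξ.1.2)).toLinearMap)
      (LinearEquiv.prodComm ℂ (V ξ.1.1) (V ξ.1.1)).toLinearMap
      (fun v => hswap ξ.1.1 ξ.1.2 v) ⟨w, hw, rfl⟩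

end EvenBundle

/-! ### The cross product of two symbols -/

theorem VectorBundle.finiteDimensional_and_finrank_fiber {M : Type*} [TopologicalSpace M]
    (F : Type*) [NormedAddCommGroup F] [NormedSpace ℂ F] [FiniteDimensional ℂ F] (E : M → Type*)
    [∀ x, NormedAddCommGroup (E x)] [∀ x, NormedSpace ℂ (E x)] [TopologicalSpace (TotalSpace F E)]
    [FiberBundle F E] [VectorBundle ℂ F E] (x : M) :
    FiniteDimensional ℂ (E x) ∧ Module.finrank ℂ (E x) = Module.finrank ℂ F := by
  let e := (FiberBundle.trivializationAt F E x).continuousLinearEquivAt ℂ x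
    (FiberBundle.mem_baseSet_trivializationAt F E x)
  exact ⟨e.symm.toLinearEquiv.finiteDimensional, e.toLinearEquiv.finrank_eq⟩

section TensorOperators

open TensorProduct (mapL)
open ContinuousLinearMap (adjoint)

variable {P : Type*} [NormedAddCommGroup P] [InnerProductSpace ℂ P]
  {Q : Type*} [NormedAddCommGroup Q] [InnerProductSpace ℂ Q]

theorem TensorProduct.bijective_mapL {a : P →L[ℂ] P} {d : Q →L[ℂ] Q} (ha : Function.Bijective a)
    (hd : Function.Bijective d) : Function.Bijective (mapL a d) := by
  rw [show (mapL a d : P ⊗[ℂ] Q → P ⊗[ℂ] Q) = TensorProduct.congr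
    (LinearEquiv.ofBijective a.toLinearMap ha) (LinearEquiv.ofBijective d.toLinearMap hd) from
      funext fun v => TensorProduct.mapL_apply a d v]
  exact LinearEquiv.bijective _

theorem TensorProduct.mapL_neg_left (a : P →L[ℂ] P) (d : Q →L[ℂ] Q) : mapL (-a) d = -mapL a d := by
  rw [← neg_one_smul ℂ a, TensorProduct.mapL_smul_left]
  exact neg_one_smul ℂ (mapL a d)

theorem TensorProduct.mapL_comm (a : P →L[ℂ] P) (d : Q →L[ℂ] Q) (v : P ⊗[ℂ] Q) :
    mapL a (.id ℂ Q) (mapL (.id ℂ P) d v) = mapL (.id ℂ P) d (mapL a (.id ℂ Q) v) := by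
  rw [← ContinuousLinearMap.comp_apply, ← ContinuousLinearMap.comp_apply, ← TensorProduct.mapL_comp,
    ← TensorProduct.mapL_comp]
  rfl

variable [CompleteSpace P] [CompleteSpace Q] [CompleteSpace (P ⊗[ℂ] Q)]

theorem TensorProduct.adjoint_mapL_id_left (d : Q →L[ℂ] Q) :
    adjoint (mapL (.id ℂ P) d) = mapL (.id ℂ P) (adjoint d) := by
  rw [TensorProduct.adjoint_mapL, ContinuousLinearMap.adjoint_id]

theorem IsSelfAdjoint.mapL_id {a : P →L[ℂ] P} (ha : IsSelfAdjoint a) :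
    IsSelfAdjoint (mapL a (.id ℂ Q)) := by
  rw [ContinuousLinearMap.isSelfAdjoint_iff', TensorProduct.adjoint_mapL,
    ContinuousLinearMap.adjoint_id, ha.adjoint_eq]

end TensorOperators

section Cross

variable {B₁ : Type*} [NormedAddCommGroup B₁] [NormedSpace ℝ B₁] [FiniteDimensional ℝ B₁]
  {H₁ : Type*} [TopologicalSpace H₁]
  {I₁ : ModelWithCorners ℝ B₁ H₁} {M₁ : Type*} [TopologicalSpace M₁] [ChartedSpace H₁ M₁]
  [IsManifold I₁ 1 M₁] [T2Space M₁] [CompactSpace M₁]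
  {B₂ : Type*} [NormedAddCommGroup B₂] [NormedSpace ℝ B₂] [FiniteDimensional ℝ B₂]
  {H₂ : Type*} [TopologicalSpace H₂]
  {I₂ : ModelWithCorners ℝ B₂ H₂} {M₂ : Type*} [TopologicalSpace M₂] [ChartedSpace H₂ M₂]
  [IsManifold I₂ 1 M₂] [T2Space M₂] [CompactSpace M₂]
  {F₁ : Type*} [NormedAddCommGroup F₁] [InnerProductSpace ℂ F₁] [FiniteDimensional ℂ F₁]
  {E₁ : M₁ → Type*} [∀ x, NormedAddCommGroup (E₁ x)] [∀ x, InnerProductSpace ℂ (E₁ x)]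
  [∀ x, CompleteSpace (E₁ x)]
  [TopologicalSpace (TotalSpace F₁ E₁)] [FiberBundle F₁ E₁] [VectorBundle ℂ F₁ E₁]
  {F₂ : Type*} [NormedAddCommGroup F₂] [InnerProductSpace ℂ F₂] [FiniteDimensional ℂ F₂]
  {E₂ : M₂ → Type*} [∀ x, NormedAddCommGroup (E₂ x)] [∀ x, InnerProductSpace ℂ (E₂ x)]
  [∀ x, CompleteSpace (E₂ x)]
  [TopologicalSpace (TotalSpace F₂ E₂)] [FiberBundle F₂ E₂] [VectorBundle ℂ F₂ E₂]
  {m₁ m₂ : ℝ}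
  {σ₁ : ∀ x : M₁, CotangentSpace I₁ x → (E₁ x →L[ℂ] E₁ x)}
  {σ₂ : ∀ x : M₂, CotangentSpace I₂ x → (E₂ x →L[ℂ] E₂ x)}

theorem TrivialEmbedding.extTensor_conj
    {A₁ : Type*} [NormedAddCommGroup A₁] [InnerProductSpace ℂ A₁] [FiniteDimensional ℂ A₁]
    {A₂ : Type*} [NormedAddCommGroup A₂] [InnerProductSpace ℂ A₂] [FiniteDimensional ℂ A₂]
    (t₁ : TrivialEmbedding ℂ F₁ E₁ A₁) (t₂ : TrivialEmbedding ℂ F₂ E₂ A₂) (x : M₁ × M₂)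
    (a : E₁ x.1 →L[ℂ] E₁ x.1) (d : E₂ x.2 →L[ℂ] E₂ x.2) (y : A₁ ⊗[ℂ] A₂) :
    (t₁.extTensor t₂).emb x (TensorProduct.mapL a d ((t₁.extTensor t₂).ret x y)) =
      TensorProduct.mapL ((t₁.emb x.1).comp (a.comp (t₁.ret x.1)))
        ((t₂.emb x.2).comp (d.comp (t₂.ret x.2))) y := by
  rw [TensorProduct.mapL_comp, TensorProduct.mapL_comp]
  rfl

/-- The swap of the two summands intertwines the cross product at antipodal covectors. -/
theorem crossSymbol_neg_swap (hσ₁_odd : ∀ x ξ, σ₁ x (-ξ) = -σ₁ x ξ)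
    (hσ₂_antipode : ∀ x ξ, σ₂ x (-ξ) = ContinuousLinearMap.adjoint (σ₂ x ξ))
    (x : M₁ × M₂) (ξ : CotangentSpace (I₁.prod I₂) x) (w : CrossBundle E₁ E₂ x) :
    Prod.swap (crossSymbol σ₁ σ₂ x ξ w) = crossSymbol σ₁ σ₂ x (-ξ) (Prod.swap w) := by
  have h1 : CotangentSpace.fst (-ξ) = -ξ.fst := rfl
  have h2 : CotangentSpace.snd (-ξ) = -ξ.snd := rfl
  simp only [crossSymbol, blockOperator_apply, h1, h2, hσ₁_odd, hσ₂_antipode, neg_neg,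
    ContinuousLinearMap.adjoint_adjoint]
  exact Prod.ext (add_comm _ _) (add_comm _ _)

/-- Away from the zero section the cross product is diagonalizable with real eigenvalues, half of
them positive. The operators `σ₁ ⊗ 1` and `1 ⊗ σ₂` commute; the second is invertible if the component
of `ξ` along `M₂` is nonzero, and otherwise it is zero and the first is invertible. -/
theorem crossSymbol_spectral (hσ₁ : IsEllipticSymbol I₁ F₁ m₁ σ₁)
    (hσ₁_selfAdjoint : ∀ x ξ, IsSelfAdjoint (σ₁ x ξ)) (hσ₂ : IsEllipticSymbol I₂ F₂ m₂ σ₂)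
    (hm₂ : 0 < m₂) (x : M₁ × M₂) {ξ : CotangentSpace (I₁.prod I₂) x} (hξ : ξ ≠ 0) :
    (∃ (b : Module.Basis (Fin (2 * (Module.finrank ℂ F₁ * Module.finrank ℂ F₂))) ℂ
        (CrossBundle E₁ E₂ x)) (c : Fin (2 * (Module.finrank ℂ F₁ * Module.finrank ℂ F₂)) → ℝ),
      ∀ i, crossSymbol σ₁ σ₂ x ξ (b i) = (c i : ℂ) • b i) ∧
    Module.finrank ℂ (nonnegSpectralSubspace
      (crossSymbol σ₁ σ₂ x ξ : CrossBundle E₁ E₂ x →ₗ[ℂ] CrossBundle E₁ E₂ x)) =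
        Module.finrank ℂ F₁ * Module.finrank ℂ F₂ := by
  obtain ⟨hd₁, hr₁⟩ := VectorBundle.finiteDimensional_and_finrank_fiber F₁ E₁ x.1
  obtain ⟨hd₂, hr₂⟩ := VectorBundle.finiteDimensional_and_finrank_fiber F₂ E₂ x.2
  have hc : CompleteSpace (E₁ x.1 ⊗[ℂ] E₂ x.2) := FiniteDimensional.complete ℂ _
  set a := TensorProduct.mapL (σ₁ x.1 ξ.fst) (.id ℂ (E₂ x.2)) with ha
  set d := TensorProduct.mapL (.id ℂ (E₁ x.1)) (σ₂ x.2 ξ.snd) with hd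
  have hsa : IsSelfAdjoint a := (hσ₁_selfAdjoint _ _).mapL_id
  have heq : crossSymbol σ₁ σ₂ x ξ = blockOperator a (ContinuousLinearMap.adjoint d) d (-a) := by
    rw [hd, TensorProduct.adjoint_mapL_id_left, ha, ← TensorProduct.mapL_neg_left]
    rfl
  have hbij : Function.Bijective a ∧ d = 0 ∨ Function.Bijective d := by
    by_cases h2 : ξ.snd = 0
    · refine Or.inl ⟨?_, ?_⟩
      · exact TensorProduct.bijective_mapL (hσ₁.elliptic _ _ fun h1 =>
          hξ (CotangentSpace.ext_fst_snd h1 h2)) Function.bijective_id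
      · rw [hd, h2, hσ₂.apply_zero hm₂, TensorProduct.mapL_zero_right]
    · exact Or.inr (TensorProduct.bijective_mapL Function.bijective_id (hσ₂.elliptic _ _ h2))
  have hrank : Module.finrank ℂ (E₁ x.1 ⊗[ℂ] E₂ x.2) =
      Module.finrank ℂ F₁ * Module.finrank ℂ F₂ := by
    rw [Module.finrank_tensorProduct, hr₁, hr₂]
  rw [heq]
  refine ⟨blockOperator_diagonalizable hsa ?_, ?_⟩
  · rw [Module.finrank_prod, hrank, two_mul]
  · rw [finrank_nonnegSpectralSubspace_blockOperator hsa (TensorProduct.mapL_comm _ _) hbij, hrank]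

/-- The cross product acts continuously, in terms of embeddings of `E₁` and `E₂` in trivial bundles.
The continuity of the adjoint of `σ₂` follows from `σ₂(-ξ) = σ₂(ξ)*`. -/
theorem continuous_crossSymbol (hσ₁ : IsEllipticSymbol I₁ F₁ m₁ σ₁) (hm₁ : 0 < m₁)
    (hσ₂ : IsEllipticSymbol I₂ F₂ m₂ σ₂) (hm₂ : 0 < m₂)
    (hσ₂_antipode : ∀ x ξ, σ₂ x (-ξ) = ContinuousLinearMap.adjoint (σ₂ x ξ))
    {A₁ : Type*} [NormedAddCommGroup A₁] [InnerProductSpace ℂ A₁] [FiniteDimensional ℂ A₁]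
    {A₂ : Type*} [NormedAddCommGroup A₂] [InnerProductSpace ℂ A₂] [FiniteDimensional ℂ A₂]
    (t₁ : TrivialEmbedding ℂ F₁ E₁ A₁) (t₂ : TrivialEmbedding ℂ F₂ E₂ A₂) :
    Continuous fun p : CotangentBundle (I₁.prod I₂) (M₁ × M₂) × ((A₁ ⊗[ℂ] A₂) × (A₁ ⊗[ℂ] A₂)) =>
      (t₁.extTensor t₂).prodSelf.emb p.1.1
        (crossSymbol σ₁ σ₂ p.1.1 p.1.2 ((t₁.extTensor t₂).prodSelf.ret p.1.1 p.2)) := by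
  obtain ⟨k₁, ⟨tT₁⟩⟩ := TrivialEmbedding.exists ℝ (B₁ →L[ℝ] ℝ) (fun x : M₁ => CotangentSpace I₁ x)
  obtain ⟨k₂, ⟨tT₂⟩⟩ := TrivialEmbedding.exists ℝ (B₂ →L[ℝ] ℝ) (fun x : M₂ => CotangentSpace I₂ x)
  have hc₁ := (hσ₁.continuous tT₁ t₁ hm₁).comp
    (continuous_cotangentSpace_fst (I₁ := I₁) (I₂ := I₂) (M₁ := M₁) (M₂ := M₂))
  have hc₂ := (hσ₂.continuous tT₂ t₂ hm₂).comp
    (continuous_cotangentSpace_snd (I₁ := I₁) (I₂ := I₂) (M₁ := M₁) (M₂ := M₂))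
  have hneg : Continuous fun ξ : CotangentBundle I₂ M₂ => (⟨ξ.1, -ξ.2⟩ : CotangentBundle I₂ M₂) := by
    convert tT₂.continuous_ret_comp (h := fun ξ => -tT₂.emb ξ.1 ξ.2)
      (FiberBundle.continuous_proj _ _) tT₂.continuous_emb.neg using 1
    funext ξ
    rw [map_neg, tT₂.ret_emb]
  have hc₂' := (hσ₂.continuous tT₂ t₂ hm₂).comp (hneg.comp
    (continuous_cotangentSpace_snd (I₁ := I₁) (I₂ := I₂) (M₁ := M₁) (M₂ := M₂)))
  have hproj : Continuous fun ξ : CotangentBundle (I₁.prod I₂) (M₁ × M₂) => ξ.1 :=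
    FiberBundle.continuous_proj _ _
  have hq₁ := t₁.continuous_emb_comp_ret.comp hproj.fst
  have hq₂ := t₂.continuous_emb_comp_ret.comp hproj.snd
  have hmapL : ∀ {f : CotangentBundle (I₁.prod I₂) (M₁ × M₂) → A₁ →L[ℂ] A₁}
      {h : CotangentBundle (I₁.prod I₂) (M₁ × M₂) → A₂ →L[ℂ] A₂}, Continuous f → Continuous h →
      Continuous fun ξ => TensorProduct.mapL (f ξ) (h ξ) := fun hf hh => by
    rw [← continuousOn_univ] at hf hh ⊢
    exact hf.mapL hh
  have hT₁ := (hmapL hc₁ hq₂).comp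
    (continuous_fst (Y := (A₁ ⊗[ℂ] A₂) × (A₁ ⊗[ℂ] A₂)))
  have hT₂ := (hmapL hq₁ hc₂).comp (continuous_fst (Y := (A₁ ⊗[ℂ] A₂) × (A₁ ⊗[ℂ] A₂)))
  have hT₃ := (hmapL hq₁ hc₂').comp (continuous_fst (Y := (A₁ ⊗[ℂ] A₂) × (A₁ ⊗[ℂ] A₂)))
  convert ((hT₁.clm_apply continuous_snd.fst).add (hT₃.clm_apply continuous_snd.snd)).prodMk
    ((hT₂.clm_apply continuous_snd.fst).sub (hT₁.clm_apply continuous_snd.snd)) using 1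
  funext p
  rw [crossSymbol, TrivialEmbedding.prodSelf_emb_blockOperator, TensorProduct.mapL_neg_left,
    neg_apply, map_neg, ← sub_eq_add_neg]
  simp only [TrivialEmbedding.extTensor_conj, ContinuousLinearMap.id_comp, ← hσ₂_antipode]
  rfl

/-- The nonnegative spectral bundle of a cross product over a product of manifolds with arbitrary
finite-dimensional models comes from `P*M` and is isomorphic to an even bundle. -/
theorem nonnegSpectralBundle_crossSymbol_even_and_descent
    (g : CotangentMetric (I₁.prod I₂) (M₁ × M₂)) (hm₁ : 0 < m₁) (hm₂ : 0 < m₂)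
    (hσ₁ : IsEllipticSymbol I₁ F₁ m₁ σ₁) (hσ₁_selfAdjoint : ∀ x ξ, IsSelfAdjoint (σ₁ x ξ))
    (hσ₁_odd : ∀ x ξ, σ₁ x (-ξ) = -σ₁ x ξ) (hσ₂ : IsEllipticSymbol I₂ F₂ m₂ σ₂)
    (hσ₂_antipode : ∀ x ξ, σ₂ x (-ξ) = ContinuousLinearMap.adjoint (σ₂ x ξ)) :
    (∃ L : ComplexVectorBundle (ProjCotangentBundle g),
      FamiliesIsomorphic
        L.Model (CosphereBundle.toProj g *ᵖ L.Fiber)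
        (CrossModel F₁ F₂) (SubspaceFamily (nonnegSpectralBundle g (crossSymbol σ₁ σ₂)))) ∧
    (∃ (G : ComplexVectorBundle (M₁ × M₂))
      (K : ∀ ξ : CosphereBundle g, Submodule ℂ ((CosphereBundle.proj g *ᵖ G.Fiber) ξ)),
      IsEvenFamily (W := G.Fiber) g K ∧
      FamiliesIsomorphic
        G.Model (SubspaceFamily (V := CosphereBundle.proj g *ᵖ G.Fiber) K)
        (CrossModel F₁ F₂) (SubspaceFamily (nonnegSpectralBundle g (crossSymbol σ₁ σ₂)))) := by
  obtain ⟨N₁, ⟨t₁⟩⟩ := TrivialEmbedding.exists ℂ F₁ E₁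
  obtain ⟨N₂, ⟨t₂⟩⟩ := TrivialEmbedding.exists ℂ F₂ E₂
  obtain ⟨k, ⟨tT⟩⟩ := TrivialEmbedding.exists ℝ (B₁ × B₂ →L[ℝ] ℝ)
    (fun x : M₁ × M₂ => CotangentSpace (I₁.prod I₂) x)
  exact nonnegSpectralBundle_even_and_descent_of_swap tT (t₁.extTensor t₂) (crossSymbol σ₁ σ₂)
    (continuous_crossSymbol hσ₁ hm₁ hσ₂ hm₂ hσ₂_antipode t₁ t₂)
    (fun x _ hξ => (crossSymbol_spectral hσ₁ hσ₁_selfAdjoint hσ₂ hm₂ x hξ).1)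
    (fun x _ hξ => (crossSymbol_spectral hσ₁ hσ₁_selfAdjoint hσ₂ hm₂ x hξ).2)
    (crossSymbol_neg_swap hσ₁_odd hσ₂_antipode)

end Cross

theorem mainTheorem8
    {n₁ n₂ : ℕ} (hn₁ : Even n₁) (hn₂ : Odd n₂)
    {M₁ : Type*} [TopologicalSpace M₁] [T2Space M₁] [CompactSpace M₁]
    [ChartedSpace (EuclideanSpace ℝ (Fin n₁)) M₁] [IsManifold (𝓡 n₁) ∞ M₁]
    {M₂ : Type*} [TopologicalSpace M₂] [T2Space M₂] [CompactSpace M₂]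
    [ChartedSpace (EuclideanSpace ℝ (Fin n₂)) M₂] [IsManifold (𝓡 n₂) ∞ M₂]
    (g : CotangentMetric ((𝓡 n₁).prod (𝓡 n₂)) (M₁ × M₂))
    {F₁ : Type*} [NormedAddCommGroup F₁] [InnerProductSpace ℂ F₁] [FiniteDimensional ℂ F₁]
    {E₁ : M₁ → Type*} [∀ x, NormedAddCommGroup (E₁ x)] [∀ x, InnerProductSpace ℂ (E₁ x)]
    [∀ x, CompleteSpace (E₁ x)]
    [TopologicalSpace (TotalSpace F₁ E₁)] [FiberBundle F₁ E₁] [VectorBundle ℂ F₁ E₁]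
    (hE₁ : IsHermitianBundle F₁ E₁)
    {F₂ : Type*} [NormedAddCommGroup F₂] [InnerProductSpace ℂ F₂] [FiniteDimensional ℂ F₂]
    {E₂ : M₂ → Type*} [∀ x, NormedAddCommGroup (E₂ x)] [∀ x, InnerProductSpace ℂ (E₂ x)]
    [∀ x, CompleteSpace (E₂ x)]
    [TopologicalSpace (TotalSpace F₂ E₂)] [FiberBundle F₂ E₂] [VectorBundle ℂ F₂ E₂]
    (hE₂ : IsHermitianBundle F₂ E₂)
    {m₁ m₂ : ℝ} (hm₁ : 0 < m₁) (hm₂ : 0 < m₂)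
    (σ₁ : ∀ x : M₁, CotangentSpace (𝓡 n₁) x → (E₁ x →L[ℂ] E₁ x))
    (hσ₁ : IsEllipticSymbol (𝓡 n₁) F₁ m₁ σ₁)
    (hσ₁_selfAdjoint : ∀ x ξ, IsSelfAdjoint (σ₁ x ξ))
    (hσ₁_odd : ∀ x ξ, σ₁ x (-ξ) = -σ₁ x ξ)
    (σ₂ : ∀ x : M₂, CotangentSpace (𝓡 n₂) x → (E₂ x →L[ℂ] E₂ x))
    (hσ₂ : IsEllipticSymbol (𝓡 n₂) F₂ m₂ σ₂)
    (hσ₂_antipode : ∀ x ξ, σ₂ x (-ξ) = ContinuousLinearMap.adjoint (σ₂ x ξ)) :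
    (∃ L : ComplexVectorBundle (ProjCotangentBundle g),
      FamiliesIsomorphic
        L.Model (CosphereBundle.toProj g *ᵖ L.Fiber)
        (CrossModel F₁ F₂) (SubspaceFamily (nonnegSpectralBundle g (crossSymbol σ₁ σ₂)))) ∧
    (∃ (G : ComplexVectorBundle (M₁ × M₂))
      (K : ∀ ξ : CosphereBundle g, Submodule ℂ ((CosphereBundle.proj g *ᵖ G.Fiber) ξ)),
      IsEvenFamily (W := G.Fiber) g K ∧
      FamiliesIsomorphic
        G.Model (SubspaceFamily (V := CosphereBundle.proj g *ᵖ G.Fiber) K)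
        (CrossModel F₁ F₂) (SubspaceFamily (nonnegSpectralBundle g (crossSymbol σ₁ σ₂)))) :=
  nonnegSpectralBundle_crossSymbol_even_and_descent g hm₁ hm₂ hσ₁ hσ₁_selfAdjoint hσ₁_odd hσ₂ hσ₂_antipode
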